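/- Let $k$ be a field, $n\ge 1$, $S=k[x_1,\dots,x_n]$ with its standard grading, $\mathfrak m=(x_1,\dots,x_n)$, and order the monomials of $S$ by the lexicographic order with $x_1>x_2>\dots>x_n$. Let $d\ge 2$, let $u\ge_{lex}v$ be monomials of degree $d$, let $$\mathcal L=\mathcal L(u,v)=\{w : w \text{ a monomial of degree } d,\ u\ge_{lex}w\ge_{lex}v\},$$ and let $I=(\mathcal L)\subset S$. Assume that $\mathcal L$ is a completely lexsegment, i.e. for every $i\ge 0$ the $i$-th iterated shadow of $\mathcal L$ is again of the form $\mathcal L(u',v')$ for monomials $u'\ge_{lex}v'$ of degree $d+i$, where the shadow of a set $T$ of monomials is $\{x_jw : w\in T,\ 1\le j\le n\}$. For monomials $w,w'$ of degree $d$ write $w\prec w'$ if the exponent of $x_1$ in $w$ is smaller than that in $w'$, or these exponents are equal and $w>_{lex}w'$. Assume that $I$ has linear quotients with respect to $\prec$, i.e. for every $w\in\mathcal L$ the colon ideal $(z\in\mathcal L : z\prec w):w$ is generated by a (possibly empty) set of variables. For $w\in\mathcal L$ put $$\operatorname{set}(w)=\{s\in\{1,\dots,n\} : x_s\in (z\in\mathcal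 L : z\prec w):w\}.$$ For a monomial $w\ne 1$ let $\max(w)$ be the largest index $s$ with $x_s\mid w$, and for $s\in\sigma\subseteq\{1,\dots,n\}$ let $\alpha(\sigma;s)=|\{t\in\sigma : t<s\}|$. Let $F_0=S$ and, for $i\ge 1$, let $F_i$ be the graded free $S$-module with homogeneous basis the symbols $f(\sigma;w)$ with $w\in\mathcal L$, $\sigma\subseteq\operatorname{set}(w)$, $|\sigma|=i-1$, where $\deg f(\sigma;w)=|\sigma|+\deg w$; put $f(\sigma;w)=0$ if $w\notin\mathcal L$ or $\sigma\not\subseteq\operatorname{set}(w)$. Then the $S$-linear maps $\partial:F_i\to F_{i-1}$ ($i\ge1$) given by $\partial(f(\emptyset;w))=w$ and, for $\sigma\neq\emptyset$, $$\partial(f(\sigma;w))=-\sum_{s\in\sigma}(-1)^{\alpha(\sigma;s)}x_s\,f(\sigma\setminus s;w)+\sum_{\substack{s\in\sigma\\ x_sw\ge_{lex}x_1v}}(-1)^{\alpha(\sigma;s)}x_1\,f\!\left(\sigma\setminus s;\tfrac{x_sw}{x_1}\right)+\sum_{\substack{s\in\sigma\\ x_sw<_{lex}x_1v}}(-1)^{\alpha(\sigma;s)}x_{\max(w)}\,f\!\left(\sigma\setminus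 s;\tfrac{x_sw}{x_{\max(w)}}\right)$$ make $\cdots\to F_2\to F_1\to F_0$, together with the canonical projection $F_0=S\to S/I$, a minimal graded free resolution of $S/I$: the modules $F_i$ are of finite rank, the augmented complex $\cdots\to F_1\to F_0\to S/I\to 0$ is exact, all maps are homogeneous of degree $0$, and $\partial(F_i)\subseteq\mathfrak mF_{i-1}$ for all $i\ge1$. -/

import Mathlib

open MvPolynomial

namespace LexsegmentResolution

/-- A monomial `x₁^{a₁} ⋯ xₙ^{aₙ}` is represented by its exponent vector; the variable `x₁` has
index `0 : Fin n`.  `a >_lex b` holds iff at the first index where the exponent vectors differ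
`a` has the larger exponent (so `x₁ > x₂ > ⋯ > xₙ`); this is the order of `Lex (Fin n →₀ ℕ)`. -/
abbrev Mon (n : ℕ) : Type := Fin n →₀ ℕ

/-- The monomial `x_s * w`. -/
noncomputable def mulVar {n : ℕ} (s : Fin n) (w : Mon n) : Mon n := w + Finsupp.single s 1

/-- The monomial `w / x_s` (used only where `x_s` divides `w`). -/
noncomputable def divVar {n : ℕ} (w : Mon n) (s : Fin n) : Mon n := w - Finsupp.single s 1

/-- `max(w)`: the largest index of a variable dividing `w` (used only for `w ≠ 1`). -/
noncomputable def maxVar {n : ℕ} [NeZero n] (w : Mon n) : Fin n := w.support.sup id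

/-- The lexsegment of the monomials `w` of degree `d` with `u ≥_lex w ≥_lex v`. -/
def lexSegment {n : ℕ} (d : ℕ) (u v : Mon n) : Set (Mon n) :=
  {w | w.degree = d ∧ toLex w ≤ toLex u ∧ toLex v ≤ toLex w}

/-- `T` is a lexsegment in degree `d`. -/
def IsLexSegment {n : ℕ} (d : ℕ) (T : Set (Mon n)) : Prop :=
  ∃ u v : Mon n, u.degree = d ∧ v.degree = d ∧ toLex v ≤ toLex u ∧ T = lexSegment d u v

/-- The shadow of a set of monomials. -/
def shadow {n : ℕ} (T : Set (Mon n)) : Set (Mon n) :=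
  {m | ∃ w ∈ T, ∃ i : Fin n, m = mulVar i w}

/-- `T` is a completely lexsegment: all its iterated shadows are lexsegments. -/
def IsCompletelyLexSegment {n : ℕ} (d : ℕ) (T : Set (Mon n)) : Prop :=
  ∀ i : ℕ, IsLexSegment (d + i) (shadow^[i] T)

/-- The order `w ≺ w'`. -/
def Prec {n : ℕ} [NeZero n] (w w' : Mon n) : Prop :=
  w 0 < w' 0 ∨ (w 0 = w' 0 ∧ toLex w' < toLex w)

section Ideals

variable (k : Type*) [Field k] {n : ℕ}

/-- The ideal of `k[x₁, …, xₙ]` generated by a set of monomials. -/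
noncomputable def monIdeal (T : Set (Mon n)) : Ideal (MvPolynomial (Fin n) k) :=
  Ideal.span ((fun w => monomial w (1 : k)) '' T)

variable [NeZero n]

/-- The colon ideal `(z ∈ T | z ≺ w) : w`. -/
noncomputable def colonIdeal (T : Set (Mon n)) (w : Mon n) : Ideal (MvPolynomial (Fin n) k) :=
  Submodule.colon (monIdeal k {z ∈ T | Prec z w}) {monomial w (1 : k)}

/-- The ideal generated by `T` has linear quotients with respect to the generators `T` ordered by
`≺`: each colon ideal is generated by variables (the first one is zero, generated by the empty
set of variables). -/
def HasLinearQuotients (T : Set (Mon n)) : Prop :=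
  ∀ w ∈ T, ∃ V : Set (Fin n), colonIdeal k T w = Ideal.span (X '' V)

open Classical in
/-- `set(w)`: the indices of the variables in the colon ideal `(z ∈ T | z ≺ w) : w`. -/
noncomputable def varSet (T : Set (Mon n)) (w : Mon n) : Finset (Fin n) :=
  Finset.univ.filter fun i => X i ∈ colonIdeal k T w

/-- The homogeneous bases of the free modules: `F₀` has one basis element, and `F_{i+1}` has the
basis of the symbols `f(σ; w)` with `w ∈ T`, `σ ⊆ set(w)` and `|σ| = i`. -/
def SymIndex (T : Set (Mon n)) : ℕ → Type
  | 0 => Unit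
  | i + 1 => {p : Finset (Fin n) × Mon n // p.2 ∈ T ∧ p.1 ⊆ varSet k T p.2 ∧ p.1.card = i}

/-- The degrees of the basis elements: `deg f(σ; w) = |σ| + deg w`. -/
noncomputable def basisDeg (T : Set (Mon n)) : ∀ i, SymIndex k T i → ℕ
  | 0 => fun _ => 0
  | _ + 1 => fun p => p.1.1.card + p.1.2.degree

/-- The free module `Fᵢ` over `k[x₁, …, xₙ]`. -/
abbrev FreeMod (T : Set (Mon n)) (i : ℕ) : Type _ := SymIndex k T i →₀ MvPolynomial (Fin n) k

/-- The generator `1` of `F₀ = k[x₁, …, xₙ]`. -/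
noncomputable def one₀ (T : Set (Mon n)) : FreeMod k T 0 := Finsupp.single () 1

open Classical in
/-- The element `f(σ; w)` of `F_{i+1}` for `|σ| = i`: a basis element if `w ∈ T` and
`σ ⊆ set(w)`, and `0` otherwise. -/
noncomputable def sym (T : Set (Mon n)) (i : ℕ) (σ : Finset (Fin n)) (w : Mon n) :
    FreeMod k T (i + 1) :=
  if h : w ∈ T ∧ σ ⊆ varSet k T w ∧ σ.card = i then Finsupp.single ⟨(σ, w), h⟩ 1 else 0

end Ideals

/-- `α(σ; s) = |{t ∈ σ | t < s}|`. -/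
def alpha {n : ℕ} (σ : Finset (Fin n)) (s : Fin n) : ℕ := (σ.filter (· < s)).card

/-- The homogeneous component of degree `j` of the graded free module `⨁_b S(-deg b)`. -/
def gradedPiece {k : Type*} [Field k] {n : ℕ} {ι : Type*} (deg : ι → ℕ) (j : ℕ) :
    Set (ι →₀ MvPolynomial (Fin n) k) :=
  {x | ∀ b, ∀ m ∈ (x b).support, m.degree + deg b = j}

/-- The complex `⋯ → F₂ → F₁ → F₀` of graded free modules `Fᵢ = ⨁_{b ∈ ι i} S(-deg i b)`,
`S = k[x₁, …, xₙ]`, with differentials `D i : F_{i+1} → F_i` and augmentation `ε : F₀ → S/I`,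
is a minimal graded free resolution of `S/I`. -/
structure IsMinimalGradedFreeResolution {k : Type*} [Field k] {n : ℕ}
    (I : Ideal (MvPolynomial (Fin n) k)) {ι : ℕ → Type*} (deg : ∀ i, ι i → ℕ)
    (D : ∀ i, (ι (i + 1) →₀ MvPolynomial (Fin n) k) →ₗ[MvPolynomial (Fin n) k]
      (ι i →₀ MvPolynomial (Fin n) k))
    (ε : (ι 0 →₀ MvPolynomial (Fin n) k) →ₗ[MvPolynomial (Fin n) k]
      (MvPolynomial (Fin n) k ⧸ I)) : Prop where
  finite_rank : ∀ i, Finite (ι i)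
  surjective : Function.Surjective ε
  exact_zero : Function.Exact (D 0) ε
  exact_succ : ∀ i, Function.Exact (D (i + 1)) (D i)
  homogeneous_augmentation : ∀ j, ∀ x ∈ gradedPiece (deg 0) j,
    ∃ p : MvPolynomial (Fin n) k, p.IsHomogeneous j ∧ ε x = Ideal.Quotient.mk I p
  homogeneous : ∀ i j, ∀ x ∈ gradedPiece (deg (i + 1)) j, D i x ∈ gradedPiece (deg i) j
  minimal : ∀ i x, D i x ∈ Ideal.span (Set.range (X : Fin n → MvPolynomial (Fin n) k)) •
    (⊤ : Submodule (MvPolynomial (Fin n) k) (ι i →₀ MvPolynomial (Fin n) k))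

end LexsegmentResolution

open LexsegmentResolution

/-! The resolution is an iterated mapping cone of Koszul complexes. Linear quotients give each
monomial of I a unique form c·w with w ∈ L and c free of the variables of set(w)
(`eq_of_add_eq_add`). Write x_s w = x_{y_s(w)} g_s(w) in this form. If moreover set(g_s(w)) ⊆
set(w), the decomposition is regular: uniqueness makes g_s and g_t commute, and the map "lower minus
Koszul" squares to zero (`differential_comp_differential`).

For a lexsegment the candidate divides x_s w by x_1 when x_s w ≥ x_1 v, and by x_max(w) otherwise.
The hard point is that the second quotient does not exceed u (`divVar_mulVar_maxVar_mem`). When u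
has one more x_1 than v, this rests on an extremal argument using both the first shadow and linear
quotients (`toLex_add_single_zero_le_of_lt`); when the x_1-exponents of u and v agree, the first
shadow is enough. An explicit description of set(w) follows (`mem_varSet_lexSegment_iff`), and
regularity is read off from it.

Exactness is a perturbation argument. Filter the symbols by the position of w in ≺. The Koszul part
keeps w and has a k-linear contracting homotopy h; the other part strictly lowers w. For a cycle x
in F_i with i ≥ 2, adding ∂(hx) therefore moves x one step down the filtration, and induction shows
that it is a boundary. In F_1 the same process reduces x to a combination of x^m f(∅; w) with x^m
free of the variables of set(w). The products x^m w are then pairwise distinct, so ∂ is injective on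
such normal forms. Minimality holds because every coefficient of ∂ is, up to sign, a variable or a
monomial w ≠ 1. -/

namespace LexsegmentResolution

/-! ### Lexicographic comparison of monomials and the order ≺. -/

section LexOrder

variable {n : ℕ}

theorem toLex_add_lt_iff {a b c : Mon n} : toLex (a + c) < toLex (b + c) ↔ toLex a < toLex b := by
  rw [toLex_add, toLex_add, add_lt_add_iff_right]

theorem toLex_add_le_iff {a b c : Mon n} : toLex (a + c) ≤ toLex (b + c) ↔ toLex a ≤ toLex b := by
  rw [toLex_add, toLex_add, add_le_add_iff_right]

theorem toLex_add_single_lt_iff {a : Mon n} {i j : Fin n} :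
    toLex (a + Finsupp.single i 1) < toLex (a + Finsupp.single j 1) ↔ j < i := by
  rw [toLex_add, toLex_add, add_lt_add_iff_left, Finsupp.Lex.single_lt_iff]

theorem toLex_add_single_le_iff {a : Mon n} {i j : Fin n} :
    toLex (a + Finsupp.single i 1) ≤ toLex (a + Finsupp.single j 1) ↔ j ≤ i := by
  rw [toLex_add, toLex_add, add_le_add_iff_left, Finsupp.Lex.single_le_iff]

theorem toLex_lt_iff_of_add_single_eq {a b : Mon n} {i j : Fin n}
    (h : a + Finsupp.single i 1 = b + Finsupp.single j 1) : toLex a < toLex b ↔ i < j := by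
  rw [← toLex_add_lt_iff (c := Finsupp.single j 1), ← h, toLex_add_single_lt_iff]

theorem toLex_le_iff_of_add_single_eq {a b : Mon n} {i j : Fin n}
    (h : a + Finsupp.single i 1 = b + Finsupp.single j 1) : toLex a ≤ toLex b ↔ i ≤ j := by
  rw [← toLex_add_le_iff (c := Finsupp.single j 1), ← h, toLex_add_single_le_iff]

theorem degree_eq_of_add_single_eq {a b : Mon n} {i j : Fin n}
    (h : a + Finsupp.single i 1 = b + Finsupp.single j 1) : a.degree = b.degree := by
  have := congrArg Finsupp.degree h
  simpa using this

/-- A monomial of degree one more than a divisor of it is a multiple by a variable. -/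
theorem exists_eq_add_single_of_le {a b : Mon n} (h : a ≤ b) (hd : b.degree = a.degree + 1) :
    ∃ j, b = a + Finsupp.single j 1 := by
  obtain ⟨c, rfl⟩ := exists_add_of_le h
  have hc : c.degree = 1 := by simpa using hd
  have hne : c ≠ 0 := by
    rintro rfl
    simp at hc
  obtain ⟨j, hj⟩ := Finsupp.support_nonempty_iff.2 hne
  have hjc : Finsupp.single j 1 ≤ c := by
    rw [Finsupp.single_le_iff]
    exact Nat.one_le_iff_ne_zero.2 (Finsupp.mem_support_iff.1 hj)
  obtain ⟨b, rfl⟩ := exists_add_of_le hjc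
  have hb : b.degree = 0 := by simpa using hc
  rw [Finsupp.degree_eq_zero_iff] at hb
  exact ⟨j, by rw [hb, add_zero]⟩

/-- Division by a variable after multiplication by another one. -/
theorem add_single_sub_single_add_single {a : Mon n} {j : Fin n} (s : Fin n) (h : a j ≠ 0) :
    a + Finsupp.single s 1 - Finsupp.single j 1 + Finsupp.single j 1 = a + Finsupp.single s 1 := by
  refine tsub_add_cancel_of_le ?_
  rw [Finsupp.single_le_iff, Finsupp.add_apply]
  omega

variable [NeZero n]

theorem toLex_lt_of_apply_zero_lt {a b : Mon n} (h : a 0 < b 0) : toLex a < toLex b :=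
  Finsupp.Lex.lt_iff.2 ⟨0, fun j hj => absurd hj (Fin.not_lt_zero j), h⟩

theorem apply_zero_le_of_toLex_le {a b : Mon n} (h : toLex a ≤ toLex b) : a 0 ≤ b 0 := by
  by_contra! hlt
  exact absurd h (toLex_lt_of_apply_zero_lt hlt).not_ge

theorem apply_zero_add_single {a : Mon n} {s : Fin n} (hs : s ≠ 0) :
    (a + Finsupp.single s 1 : Mon n) 0 = a 0 := by
  simp [hs]

theorem apply_zero_add_single_zero {a : Mon n} :
    (a + Finsupp.single 0 1 : Mon n) 0 = a 0 + 1 := by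
  simp

theorem le_maxVar {w : Mon n} {j : Fin n} (h : w j ≠ 0) : j ≤ maxVar w :=
  Finset.le_sup (f := id) (Finsupp.mem_support_iff.2 h)

theorem apply_maxVar_ne_zero {w : Mon n} (h : w ≠ 0) : w (maxVar w) ≠ 0 := by
  have hne : w.support.Nonempty := Finsupp.support_nonempty_iff.2 h
  obtain ⟨i, hi, he⟩ := Finset.exists_mem_eq_sup w.support hne id
  rw [maxVar, he]
  exact Finsupp.mem_support_iff.1 hi

theorem apply_maxVar_ne_zero_of_lt {w : Mon n} {s : Fin n} (h : s < maxVar w) :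
    w (maxVar w) ≠ 0 := by
  apply apply_maxVar_ne_zero
  rintro rfl
  simp [maxVar] at h

theorem Prec.irrefl (w : Mon n) : ¬ Prec w w := by
  simp [Prec]

theorem Prec.trans {a b c : Mon n} (h₁ : Prec a b) (h₂ : Prec b c) : Prec a c := by
  rcases h₁ with h₁ | ⟨h₁, h₁'⟩ <;> rcases h₂ with h₂ | ⟨h₂, h₂'⟩
  · exact Or.inl (h₁.trans h₂)
  · exact Or.inl (h₂ ▸ h₁)
  · exact Or.inl (h₁ ▸ h₂)
  · exact Or.inr ⟨h₁.trans h₂, h₂'.trans h₁'⟩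

theorem Prec.trichotomous (a b : Mon n) : Prec a b ∨ a = b ∨ Prec b a := by
  rcases lt_trichotomy (a 0) (b 0) with h | h | h
  · exact Or.inl (Or.inl h)
  · rcases lt_trichotomy (toLex a) (toLex b) with h' | h' | h'
    · exact Or.inr (Or.inr (Or.inr ⟨h.symm, h'⟩))
    · exact Or.inr (Or.inl (toLex.injective h'))
    · exact Or.inl (Or.inr ⟨h, h'⟩)
  · exact Or.inr (Or.inr (Or.inl h))

end LexOrder

/-! ### Colon ideals tested on monomials. -/

section Colon

variable {k : Type*} [Field k] {n : ℕ}

open Classical in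
theorem monomial_mem_monIdeal_iff {T : Set (Mon n)} {m : Mon n} :
    monomial m (1 : k) ∈ monIdeal k T ↔ ∃ z ∈ T, z ≤ m := by
  rw [monIdeal, mem_ideal_span_monomial_image, support_monomial, if_neg one_ne_zero]
  simp

variable [NeZero n]

theorem monomial_mem_colonIdeal_iff {T : Set (Mon n)} {w c : Mon n} :
    monomial c (1 : k) ∈ colonIdeal k T w ↔ ∃ z ∈ T, Prec z w ∧ z ≤ c + w := by
  rw [colonIdeal, Submodule.mem_colon_singleton, smul_eq_mul, monomial_mul, one_mul,
    monomial_mem_monIdeal_iff]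
  simp [and_assoc]

open Classical in
theorem mem_varSet_iff {T : Set (Mon n)} {w : Mon n} {t : Fin n} :
    t ∈ varSet k T w ↔ ∃ z ∈ T, Prec z w ∧ z ≤ Finsupp.single t 1 + w := by
  rw [varSet, Finset.mem_filter, ← monomial_mem_colonIdeal_iff (k := k)]
  simp [X]

theorem mem_varSet_iff_of_degree {T : Set (Mon n)} {d : ℕ} (hT : ∀ z ∈ T, z.degree = d)
    {w : Mon n} (hw : w ∈ T) {t : Fin n} :
    t ∈ varSet k T w ↔
      ∃ z ∈ T, Prec z w ∧ ∃ j, w + Finsupp.single t 1 = z + Finsupp.single j 1 := by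
  rw [mem_varSet_iff]
  refine exists_congr fun z => and_congr_right fun hz => and_congr_right fun _ => ?_
  rw [add_comm]
  constructor
  · intro h
    exact exists_eq_add_single_of_le h (by simp [hT z hz, hT w hw])
  · rintro ⟨j, hj⟩
    rw [hj]
    exact le_self_add

theorem colonIdeal_eq_span_varSet {T : Set (Mon n)} (h : HasLinearQuotients k T) {w : Mon n}
    (hw : w ∈ T) : colonIdeal k T w = Ideal.span (X '' (varSet k T w : Set (Fin n))) := by
  obtain ⟨V, hV⟩ := h w hw
  have : (varSet k T w : Set (Fin n)) = V := by
    ext i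
    simp only [varSet, Finset.coe_filter, Finset.mem_univ, true_and, Set.mem_ofPred_eq, hV]
    rw [mem_ideal_span_X_image]
    simp only [support_X, Finset.mem_singleton, forall_eq, Finsupp.single_apply]
    simp
  rw [this, hV]

open Classical in
/-- The colon ideals of an ideal with linear quotients, on monomials. -/
theorem exists_prec_le_iff_exists_mem_varSet {T : Set (Mon n)} (h : HasLinearQuotients k T)
    {w c : Mon n} (hw : w ∈ T) :
    (∃ z ∈ T, Prec z w ∧ z ≤ c + w) ↔ ∃ i ∈ varSet k T w, c i ≠ 0 := by
  rw [← monomial_mem_colonIdeal_iff (k := k), colonIdeal_eq_span_varSet h hw,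
    mem_ideal_span_X_image, support_monomial, if_neg one_ne_zero]
  simp

end Colon

end LexsegmentResolution

namespace LexsegmentResolution

/-! ### Quotients staying in the lexsegment, and the description of set(w). -/

section Lexsegment

variable {k : Type*} [Field k] {n d : ℕ} {u v : Mon n}

theorem lexSegment_finite (d : ℕ) (u v : Mon n) : (lexSegment d u v).Finite :=
  (Finsupp.finite_of_degree_le d).subset fun _ hw => hw.1.le

theorem add_single_mem_shadow {T : Set (Mon n)} {w : Mon n} (hw : w ∈ T) (i : Fin n) :
    w + Finsupp.single i 1 ∈ shadow T :=
  ⟨w, hw, i, rfl⟩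

/-- Lexsegments are order-convex in their degree. Completeness enters the proof only through this
property of the first shadow. -/
theorem IsCompletelyLexSegment.mem_shadow {T : Set (Mon n)} (h : IsCompletelyLexSegment d T)
    {a b c : Mon n} (ha : a ∈ shadow T) (hc : c ∈ shadow T) (hab : toLex a ≤ toLex b)
    (hbc : toLex b ≤ toLex c) (hb : b.degree = d + 1) : b ∈ shadow T := by
  obtain ⟨u, v, -, -, -, he⟩ := h 1
  rw [Function.iterate_one] at he
  rw [he] at ha hc ⊢
  exact ⟨hb, hbc.trans hc.2.1, ha.2.2.trans hab⟩

variable [NeZero n]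

/-- In a completely lexsegment with linear quotients whose ends have `x₁`-degrees differing by
one, each monomial `m < v` with the `x₁`-degree of `v` satisfies `x₁ m / x_max(m) ≤ u`. -/
theorem toLex_add_single_zero_le_of_lt (hv : v.degree = d) (huv : u 0 = v 0 + 1)
    (hu : u.degree = d) (hcomplete : IsCompletelyLexSegment d (lexSegment d u v))
    (hquot : HasLinearQuotients k (lexSegment d u v)) {m : Mon n} {M : Fin n}
    (hd : m.degree = d) (h0 : m 0 = v 0) (hm : toLex m < toLex v) (hM0 : M ≠ 0) (hM : m M ≠ 0)
    (hmax : ∀ j, m j ≠ 0 → j ≤ M) :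
    toLex (m + Finsupp.single 0 1) ≤ toLex (u + Finsupp.single M 1) := by
  by_contra! hcon
  -- B is the set of counterexamples; a lexicographically largest one is taken.
  let B : Set (Mon n) := {m | m.degree = d ∧ m 0 = v 0 ∧ toLex m < toLex v ∧ ∃ M : Fin n, M ≠ 0 ∧
    m M ≠ 0 ∧ (∀ j, m j ≠ 0 → j ≤ M) ∧
    toLex (u + Finsupp.single M 1) < toLex (m + Finsupp.single 0 1)}
  have hB : B.Finite := (Finsupp.finite_of_degree_le d).subset fun _ hw => hw.1.le
  obtain ⟨m, ⟨hd, h0, hm, M, hM0, hM, hmax, hcon⟩, hmaxi⟩ :=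
    hB.exists_maximalFor toLex B ⟨m, hd, h0, hm, M, hM0, hM, hmax, hcon⟩
  have hvu : toLex v < toLex u := toLex_lt_of_apply_zero_lt (by omega)
  have huL : u ∈ lexSegment d u v := ⟨hu, le_rfl, hvu.le⟩
  have hvL : v ∈ lexSegment d u v := ⟨hv, hvu.le, le_rfl⟩
  have hsh : m + Finsupp.single 0 1 ∈ shadow (lexSegment d u v) := by
    refine hcomplete.mem_shadow (add_single_mem_shadow hvL M) (add_single_mem_shadow huL 0)
      (toLex_lt_of_apply_zero_lt ?_).le (toLex_add_le_iff.2 (hm.trans hvu).le) (by simp [hd])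
    rw [apply_zero_add_single hM0, apply_zero_add_single_zero]
    omega
  let A : Set (Fin n) :=
    {i | ∃ w ∈ lexSegment d u v, m + Finsupp.single 0 1 = w + Finsupp.single i 1}
  obtain ⟨w, hw, i, hi⟩ := hsh
  -- Among the factorizations x_1 m = P x_i with P ∈ L, take one with i as large as possible; this
  -- is what contradicts x_i ∈ (… : P) at the end.
  obtain ⟨i, ⟨P, hP, hi⟩, himax⟩ := (Set.toFinite A).exists_maximalFor id A ⟨i, w, hw, hi⟩
  have hne0 : ∀ {w j}, w ∈ lexSegment d u v → m + Finsupp.single 0 1 = w + Finsupp.single j 1 →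
      j ≠ 0 := by
    rintro w j hw h rfl
    rw [add_left_inj] at h
    subst h
    exact absurd hw.2.2 hm.not_ge
  have hi0 : i ≠ 0 := hne0 hP hi
  have hmi : m i ≠ 0 := by
    have := DFunLike.congr_fun hi i
    simp [hi0.symm] at this
    omega
  have hiM : i < M := by
    refine lt_of_le_of_ne (hmax i hmi) ?_
    rintro rfl
    rw [hi, toLex_add_lt_iff] at hcon
    exact absurd hP.2.1 hcon.not_ge
  have hz := add_single_sub_single_add_single i hM
  set z := m + Finsupp.single i 1 - Finsupp.single M 1 with hzdef
  have hzd : z.degree = d := by rw [degree_eq_of_add_single_eq hz, hd]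
  have hz0 : z 0 = v 0 := by
    have := DFunLike.congr_fun hz 0
    rw [apply_zero_add_single hM0, apply_zero_add_single hi0] at this
    omega
  have hmz : toLex m < toLex z := (toLex_lt_iff_of_add_single_eq hz.symm).2 hiM
  -- If z = m x_i / x_M were below v, it would be a counterexample larger than m, since max(z) ≥ i
  -- and multiplying u x_M < m x_1 by x_i, then cancelling x_M, gives u x_i < z x_1.
  have hvz : toLex v ≤ toLex z := by
    by_contra! hlt
    have hzi : z i ≠ 0 := by
      have := DFunLike.congr_fun hz i
      simp [hiM.ne'] at this
      omega
    refine absurd (hmaxi (j := z) ⟨hzd, hz0, hlt, maxVar z, ?_, ?_, fun j => le_maxVar, ?_⟩ hmz.le)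
      hmz.not_ge
    · have := le_maxVar hzi
      intro h
      rw [h] at this
      exact hi0 (le_antisymm this (Fin.zero_le _))
    · exact apply_maxVar_ne_zero fun h => hzi (by rw [h]; rfl)
    · calc toLex (u + Finsupp.single (maxVar z) 1) ≤ toLex (u + Finsupp.single i 1) :=
            toLex_add_single_le_iff.2 (le_maxVar hzi)
        _ < toLex (z + Finsupp.single 0 1) := by
            rw [← toLex_add_lt_iff (c := Finsupp.single M 1), add_right_comm z, hz,
              add_right_comm m, add_right_comm u, toLex_add_lt_iff]
            exact hcon
  have hzL : z ∈ lexSegment d u v := ⟨hzd, (toLex_lt_of_apply_zero_lt (by omega)).le, hvz⟩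
  have hP0 : P 0 = m 0 + 1 := by
    have := DFunLike.congr_fun hi 0
    rw [apply_zero_add_single hi0, apply_zero_add_single_zero] at this
    omega
  -- The generator z precedes P and divides x_i² P = x_i x_1 m = z x_M x_1. Linear quotients replace
  -- x_i² by x_i.
  have hcol : ∃ j ∈ varSet k (lexSegment d u v) P, Finsupp.single i 2 j ≠ 0 := by
    refine (exists_prec_le_iff_exists_mem_varSet hquot hP).1 ⟨z, hzL, Or.inl (by omega), ?_⟩
    have : Finsupp.single i 2 + P = z + (Finsupp.single M 1 + Finsupp.single 0 1) := by
      rw [← add_assoc, hz, add_right_comm, hi, add_assoc, ← Finsupp.single_add, add_comm]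
    rw [this]
    exact le_self_add
  obtain ⟨j, hj, hji⟩ := hcol
  obtain rfl : j = i := by
    by_contra h
    exact hji (by simp [Ne.symm h])
  obtain ⟨z', hz', hpz, l, hl⟩ := (mem_varSet_iff_of_degree (fun z hz => hz.1) hP).1 hj
  have hl0 := hne0 hz' (hi.trans hl)
  have hlj : l ≤ j := le_of_not_gt fun h => absurd (himax (j := l) ⟨z', hz', hi.trans hl⟩ h.le)
    h.not_ge
  -- Now P x_i = z' x_l with z' ≺ P. Both variables differ from x_1, so z' and P have the same
  -- x_1-exponent and z' > P, that is, l > i, against the maximality of i.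
  rcases hpz with hpz | ⟨-, hpz⟩
  · have := DFunLike.congr_fun hl 0
    rw [apply_zero_add_single hi0, apply_zero_add_single hl0] at this
    omega
  · exact absurd hpz ((toLex_le_iff_of_add_single_eq hl.symm).2 hlj).not_gt

/-- Only the bound by u is in question. If the quotient q exceeded u, then u, w and q would share
their x_1-exponent, which is that of v or one more. In the latter case the extremal lemma applies to
m = x_s w / x_1. In the former, x_2 q lies between x_2 u and x_1 u, hence in the shadow, and the
generator it comes from has too few x_1. -/
theorem divVar_mulVar_maxVar_mem (hu : u.degree = d) (hv : v.degree = d)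
    (hcomplete : IsCompletelyLexSegment d (lexSegment d u v))
    (hquot : HasLinearQuotients k (lexSegment d u v)) {w : Mon n} {s : Fin n}
    (hw : w ∈ lexSegment d u v) (hs : s ≠ 0)
    (hlt : toLex (mulVar s w) < toLex (mulVar 0 v)) (hsM : s < maxVar w) :
    divVar (mulVar s w) (maxVar w) ∈ lexSegment d u v := by
  unfold mulVar at hlt
  have hMw := apply_maxVar_ne_zero_of_lt hsM
  have hM0 : maxVar w ≠ 0 := (lt_of_le_of_lt (Fin.zero_le _) hsM).ne'
  have hq := add_single_sub_single_add_single s hMw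
  change w + Finsupp.single s 1 - Finsupp.single (maxVar w) 1 ∈ _
  set q := w + Finsupp.single s 1 - Finsupp.single (maxVar w) 1
  have hqd : q.degree = d := by rw [degree_eq_of_add_single_eq hq, hw.1]
  have hwq : toLex w < toLex q := (toLex_lt_iff_of_add_single_eq hq.symm).2 hsM
  refine ⟨hqd, ?_, hw.2.2.trans hwq.le⟩
  by_contra! hcon
  have hq0 : q 0 = w 0 := by
    have := DFunLike.congr_fun hq 0
    rwa [apply_zero_add_single hM0, apply_zero_add_single hs] at this
  have h1 := apply_zero_le_of_toLex_le hw.2.1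
  have h2 := apply_zero_le_of_toLex_le hcon.le
  have h3 := apply_zero_le_of_toLex_le hw.2.2
  have h4 := apply_zero_le_of_toLex_le hlt.le
  rw [apply_zero_add_single hs, apply_zero_add_single_zero] at h4
  have hvu : toLex v ≤ toLex u := hw.2.2.trans hw.2.1
  have huL : u ∈ lexSegment d u v := ⟨hu, le_rfl, hvu⟩
  rcases Nat.lt_or_ge (v 0) (w 0) with h5 | h5
  · have hw0 : w 0 ≠ 0 := by omega
    have hm := add_single_sub_single_add_single s hw0
    set m := w + Finsupp.single s 1 - Finsupp.single 0 1
    have hm0 : m 0 = v 0 := by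
      have := DFunLike.congr_fun hm 0
      rw [apply_zero_add_single hs, apply_zero_add_single_zero] at this
      omega
    have hmj : ∀ j, j ≠ 0 → (m j = w j ∨ (m j = w j + 1 ∧ j = s)) := by
      intro j hj
      have := DFunLike.congr_fun hm j
      simp only [Finsupp.add_apply, Finsupp.single_apply, hj.symm, if_false] at this
      split_ifs at this with h
      · exact Or.inr ⟨this, h.symm⟩
      · exact Or.inl this
    have := toLex_add_single_zero_le_of_lt (k := k) (m := m) (M := maxVar w) hv (by omega) hu
      hcomplete hquot (by rw [degree_eq_of_add_single_eq hm, hw.1]) hm0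
      (by rwa [← hm, toLex_add_lt_iff] at hlt) hM0 (by rcases hmj _ hM0 with h | h <;> omega) ?_
    · rw [hm, ← hq, toLex_add_le_iff] at this
      exact absurd hcon this.not_gt
    · intro j hj
      by_cases h0 : j = 0
      · rw [h0]
        exact Fin.zero_le _
      · rcases hmj j h0 with h | h
        · exact le_maxVar (h ▸ hj)
        · rw [h.2]
          exact hsM.le
  · have hn : 1 < n := lt_of_le_of_lt (Fin.pos_iff_ne_zero.2 hs) s.2
    let t : Fin n := ⟨1, hn⟩
    have ht : t ≠ 0 := by
      rw [Ne, Fin.ext_iff]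
      simp [t]
    obtain ⟨z, hz, j, hj⟩ : q + Finsupp.single t 1 ∈ shadow (lexSegment d u v) := by
      refine hcomplete.mem_shadow (add_single_mem_shadow huL t) (add_single_mem_shadow huL 0)
        (toLex_add_le_iff.2 hcon.le) (toLex_lt_of_apply_zero_lt ?_).le (by simp [hqd])
      rw [apply_zero_add_single ht, apply_zero_add_single_zero]
      omega
    have hjt : j < t := (toLex_lt_iff_of_add_single_eq hj.symm).1 (hz.2.1.trans_lt hcon)
    obtain rfl : j = 0 := by
      by_contra h
      have h1 : j.1 < 1 := hjt
      have h2 := Fin.lt_def.1 (Fin.pos_iff_ne_zero.2 h)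
      omega
    have := DFunLike.congr_fun hj 0
    have h6 := apply_zero_le_of_toLex_le hz.2.2
    unfold mulVar at this
    rw [apply_zero_add_single ht, apply_zero_add_single_zero] at this
    omega

variable (k) in
/-- The variables in the colon ideals of a completely lexsegment with linear quotients. -/
theorem mem_varSet_lexSegment_iff (hu : u.degree = d) (hv : v.degree = d)
    (hcomplete : IsCompletelyLexSegment d (lexSegment d u v))
    (hquot : HasLinearQuotients k (lexSegment d u v)) {w : Mon n}
    (hw : w ∈ lexSegment d u v) {t : Fin n} :
    t ∈ varSet k (lexSegment d u v) w ↔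
      t ≠ 0 ∧ (toLex (mulVar 0 v) ≤ toLex (mulVar t w) ∨ t < maxVar w) := by
  rw [mem_varSet_iff_of_degree (fun z hz => hz.1) hw]
  constructor
  · rintro ⟨z, hz, hzw, j, hj⟩
    have ht : t ≠ 0 := by
      rintro rfl
      by_cases hj0 : j = 0
      · rw [hj0, add_left_inj] at hj
        exact Prec.irrefl _ (hj ▸ hzw)
      · have := DFunLike.congr_fun hj 0
        rw [apply_zero_add_single hj0, apply_zero_add_single_zero] at this
        rcases hzw with h | h <;> omega
    refine ⟨ht, ?_⟩
    by_cases hj0 : j = 0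
    · left
      rw [mulVar, mulVar, hj, hj0, toLex_add_le_iff]
      exact hz.2.2
    · right
      have h0 := DFunLike.congr_fun hj 0
      rw [apply_zero_add_single hj0, apply_zero_add_single ht] at h0
      have hwz : toLex w < toLex z := by
        rcases hzw with h | h
        · omega
        · exact h.2
      have htj := (toLex_lt_iff_of_add_single_eq hj).1 hwz
      refine htj.trans_le (le_maxVar ?_)
      have := DFunLike.congr_fun hj j
      simp [htj.ne] at this
      omega
  · rintro ⟨ht, h⟩
    -- The preceding generator is the one occurring in the differential: x_t w / x_max(w),
    -- lexicographically larger than w with the same x_1-exponent, or x_t w / x_1, with a smaller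
    -- x_1-exponent.
    by_cases hlt : toLex (mulVar t w) < toLex (mulVar 0 v)
    · have htM := h.resolve_left hlt.not_ge
      have hz := add_single_sub_single_add_single t (apply_maxVar_ne_zero_of_lt htM)
      refine ⟨_, divVar_mulVar_maxVar_mem hu hv hcomplete hquot hw ht hlt htM, Or.inr ⟨?_, ?_⟩,
        maxVar w, hz.symm⟩
      · have := DFunLike.congr_fun hz 0
        rwa [apply_zero_add_single (lt_of_le_of_lt (Fin.zero_le _) htM).ne',
          apply_zero_add_single ht] at this
      · exact (toLex_lt_iff_of_add_single_eq hz.symm).2 htM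
    · rw [not_lt] at hlt
      unfold mulVar at hlt
      have h0 := apply_zero_le_of_toLex_le hlt
      rw [apply_zero_add_single ht, apply_zero_add_single_zero] at h0
      have hz := add_single_sub_single_add_single t (a := w) (j := 0) (by omega)
      have hzw := (toLex_lt_iff_of_add_single_eq hz).2 (Fin.pos_iff_ne_zero.2 ht)
      refine ⟨w + Finsupp.single t 1 - Finsupp.single 0 1, ⟨?_, hzw.le.trans hw.2.1, ?_⟩,
        Or.inl ?_, 0, hz.symm⟩
      · rw [degree_eq_of_add_single_eq hz, hw.1]
      · rwa [← hz, toLex_add_le_iff] at hlt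
      · have := DFunLike.congr_fun hz 0
        rw [apply_zero_add_single ht, apply_zero_add_single_zero] at this
        omega

end Lexsegment

end LexsegmentResolution

namespace LexsegmentResolution

/-! ### Regular decomposition functions. -/

section Decomposition

variable (k : Type*) [Field k] {n : ℕ} [NeZero n]

/-- A regular decomposition function for the generators `T`: `x_s w = x_{y s w} (g s w)` where
`y s w ∉ set (g s w)` and `set (g s w) ⊆ set w`; here `g s w = w` for `s ∉ set w`. -/
structure IsRegularDecomposition (T : Set (Mon n)) (y : Fin n → Mon n → Fin n)
    (g : Fin n → Mon n → Mon n) : Prop where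
  mem : ∀ w ∈ T, ∀ s, g s w ∈ T
  mulVar_eq : ∀ w ∈ T, ∀ s, mulVar (y s w) (g s w) = mulVar s w
  notMem : ∀ w ∈ T, ∀ s, y s w ∉ varSet k T (g s w)
  subset : ∀ w ∈ T, ∀ s, varSet k T (g s w) ⊆ varSet k T w
  eq_of_notMem : ∀ w ∈ T, ∀ s, s ∉ varSet k T w → y s w = s ∧ g s w = w

variable {k} {T : Set (Mon n)} {y : Fin n → Mon n → Fin n} {g : Fin n → Mon n → Mon n}

/-- A monomial is in a unique way the product of a generator `w` and a monomial in the variables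
outside `set w`. -/
theorem eq_of_add_eq_add (hT : HasLinearQuotients k T) {w w' c c' : Mon n} (hw : w ∈ T)
    (hw' : w' ∈ T) (hc : ∀ i ∈ varSet k T w, c i = 0) (hc' : ∀ i ∈ varSet k T w', c' i = 0)
    (h : c + w = c' + w') : w = w' := by
  rcases Prec.trichotomous w w' with hp | hp | hp
  · obtain ⟨i, hi, hne⟩ := (exists_prec_le_iff_exists_mem_varSet hT hw').1
      ⟨w, hw, hp, h ▸ (le_add_self : w ≤ c + w)⟩
    exact absurd (hc' i hi) hne
  · exact hp
  · obtain ⟨i, hi, hne⟩ := (exists_prec_le_iff_exists_mem_varSet hT hw).1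
      ⟨w', hw', hp, h ▸ (le_add_self : w' ≤ c' + w')⟩
    exact absurd (hc i hi) hne

namespace IsRegularDecomposition

theorem add_single_eq (hg : IsRegularDecomposition k T y g) {w : Mon n} (hw : w ∈ T) (s : Fin n) :
    g s w + Finsupp.single (y s w) 1 = w + Finsupp.single s 1 :=
  hg.mulVar_eq w hw s

/-- Otherwise x_{y_s(w)} would lie in the colon ideal of g_s(w): if g_s(w) = w then y_s(w) = s, and
if w comes first then w divides x_{y_s(w)} g_s(w). This strict descent drives the induction for
exactness. -/
theorem prec (hg : IsRegularDecomposition k T y g) {w : Mon n} (hw : w ∈ T)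
    {s : Fin n} (hs : s ∈ varSet k T w) : Prec (g s w) w := by
  rcases Prec.trichotomous (g s w) w with hp | hp | hp
  · exact hp
  · have h := hg.add_single_eq hw s
    rw [hp, add_right_inj] at h
    have hys : y s w = s := (Finsupp.single_left_inj one_ne_zero).1 h
    have := hg.notMem w hw s
    rw [hp, hys] at this
    exact absurd hs this
  · refine absurd (mem_varSet_iff.2 ⟨w, hw, hp, ?_⟩) (hg.notMem w hw s)
    rw [add_comm, hg.add_single_eq hw s]
    exact le_self_add

/-- Both sides are the generator in the unique decomposition of x_s x_t w. Regularity is needed to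
know that the variable split off first stays outside the set of the final generator. -/
theorem comm (hg : IsRegularDecomposition k T y g) (hT : HasLinearQuotients k T) {w : Mon n}
    (hw : w ∈ T) (s t : Fin n) : g t (g s w) = g s (g t w) := by
  have key : ∀ s t, Finsupp.single (y t (g s w)) 1 + Finsupp.single (y s w) 1 + g t (g s w) =
      w + (Finsupp.single s 1 + Finsupp.single t 1) := by
    intro s t
    rw [add_comm, ← add_assoc, hg.add_single_eq (hg.mem w hw s), add_right_comm,
      hg.add_single_eq hw, add_assoc]
  have hvar : ∀ s t, ∀ i ∈ varSet k T (g t (g s w)),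
      (Finsupp.single (y t (g s w)) 1 + Finsupp.single (y s w) 1 : Mon n) i = 0 := by
    intro s t i hi
    have h1 : y t (g s w) ≠ i := fun h => hg.notMem _ (hg.mem w hw s) t (h ▸ hi)
    have h2 : y s w ≠ i := fun h => hg.notMem w hw s (h ▸ hg.subset _ (hg.mem w hw s) t hi)
    simp [h1, h2]
  refine eq_of_add_eq_add hT (hg.mem _ (hg.mem w hw s) t) (hg.mem _ (hg.mem w hw t) s)
    (hvar s t) (hvar t s) ?_
  rw [key, key, add_comm (Finsupp.single s 1)]

theorem X_mul_X_comm (hg : IsRegularDecomposition k T y g) (hT : HasLinearQuotients k T)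
    {w : Mon n} (hw : w ∈ T) (s t : Fin n) :
    (X (y s w) * X (y t (g s w)) : MvPolynomial (Fin n) k) = X (y t w) * X (y s (g t w)) := by
  have h : Finsupp.single (y s w) 1 + Finsupp.single (y t (g s w)) 1 =
      Finsupp.single (y t w) 1 + Finsupp.single (y s (g t w)) 1 := by
    have h1 := hg.add_single_eq (hg.mem w hw s) t
    have h2 := hg.add_single_eq (hg.mem w hw t) s
    rw [← add_left_cancel_iff (a := g t (g s w)), add_left_comm, add_comm, h1, add_right_comm,
      hg.add_single_eq hw, hg.comm hT hw, add_left_comm, h2, add_left_comm,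
      ← add_assoc, hg.add_single_eq hw, add_right_comm]
  simp only [X, monomial_mul, h]

end IsRegularDecomposition

end Decomposition

/-! ### The decomposition function of a lexsegment. -/

section Lexsegment

variable (k : Type*) [Field k] {n d : ℕ} [NeZero n] {u v : Mon n}

open Classical in
/-- The variable `x_s w / g(x_s w)` for the decomposition function `g` of a lexsegment. -/
noncomputable def lexVar (T : Set (Mon n)) (v : Mon n) (s : Fin n) (w : Mon n) : Fin n :=
  if s ∈ varSet k T w then
    if toLex (mulVar 0 v) ≤ toLex (mulVar s w) then 0 else maxVar w
  else s

theorem isRegularDecomposition_lexVar (hu : u.degree = d) (hv : v.degree = d)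
    (hcomplete : IsCompletelyLexSegment d (lexSegment d u v))
    (hquot : HasLinearQuotients k (lexSegment d u v)) :
    IsRegularDecomposition k (lexSegment d u v) (lexVar k (lexSegment d u v) v)
      fun s w => divVar (mulVar s w) (lexVar k (lexSegment d u v) v s w) := by
  have key : ∀ w ∈ lexSegment d u v, ∀ s y z, y = lexVar k (lexSegment d u v) v s w →
      z = divVar (mulVar s w) y → z ∈ lexSegment d u v ∧ mulVar y z = mulVar s w ∧
      y ∉ varSet k (lexSegment d u v) z ∧
      varSet k (lexSegment d u v) z ⊆ varSet k (lexSegment d u v) w := by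
    intro w hw s y z hy hz
    have hiff := fun {w} (hw : w ∈ lexSegment d u v) {t} =>
      mem_varSet_lexSegment_iff k hu hv hcomplete hquot hw (t := t)
    by_cases hs : s ∈ varSet k (lexSegment d u v) w
    · have hs' := (hiff hw).1 hs
      by_cases hle : toLex (mulVar 0 v) ≤ toLex (mulVar s w)
      · rw [lexVar, if_pos hs, if_pos hle] at hy
        subst hy
        have h0 := apply_zero_le_of_toLex_le hle
        unfold mulVar at h0
        rw [apply_zero_add_single hs'.1, apply_zero_add_single_zero] at h0
        have hzs : z + Finsupp.single 0 1 = w + Finsupp.single s 1 := by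
          rw [hz]
          exact add_single_sub_single_add_single s (by omega)
        have hzw : toLex z < toLex w :=
          (toLex_lt_iff_of_add_single_eq hzs).2 (Fin.pos_iff_ne_zero.2 hs'.1)
        have hzL : z ∈ lexSegment d u v := by
          refine ⟨?_, hzw.le.trans hw.2.1, ?_⟩
          · rw [degree_eq_of_add_single_eq hzs, hw.1]
          · unfold mulVar at hle
            rwa [← hzs, toLex_add_le_iff] at hle
        refine ⟨hzL, hzs, fun h => ((hiff hzL).1 h).1 rfl, fun t ht => ?_⟩
        rw [hiff hzL] at ht
        rw [hiff hw]
        refine ⟨ht.1, ?_⟩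
        rcases ht.2 with h | h
        · exact Or.inl (h.trans (toLex_add_le_iff.2 hzw.le))
        -- For t ≤ s, x_t w ≥ x_s w ≥ x_1 v. For t > s, also max(z) > s, so x_max(z) already divides
        -- w and t < max(w).
        · by_cases hts : t ≤ s
          · exact Or.inl (hle.trans (toLex_add_single_le_iff.2 hts))
          · right
            refine h.trans_le (le_maxVar ?_)
            have h1 := DFunLike.congr_fun hzs (maxVar z)
            have h2 := apply_maxVar_ne_zero_of_lt h
            have h3 : s ≠ maxVar z := fun h' => hts (h' ▸ h.le)
            simp [h3] at h1
            omega
      · have hsM := hs'.2.resolve_left hle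
        rw [lexVar, if_pos hs, if_neg hle] at hy
        subst hy
        rw [not_le] at hle
        have hzs : z + Finsupp.single (maxVar w) 1 = w + Finsupp.single s 1 := by
          rw [hz]
          exact add_single_sub_single_add_single s (apply_maxVar_ne_zero_of_lt hsM)
        have hzL : z ∈ lexSegment d u v := by
          rw [hz]
          exact divVar_mulVar_maxVar_mem hu hv hcomplete hquot hw hs'.1 hle hsM
        have hmax : maxVar z ≤ maxVar w := by
          refine Finset.sup_le fun j hj => ?_
          by_cases hjs : s = j
          · exact hjs ▸ hsM.le
          · refine le_maxVar (j := j) ?_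
            rw [Finsupp.mem_support_iff] at hj
            have h1 := DFunLike.congr_fun hzs j
            simp [hjs] at h1
            omega
        -- An index t ≥ max(w) would give x_t z ≤ x_max(w) z = x_s w < x_1 v, and max(z) ≤ max(w)
        -- excludes the other alternative.
        have hlt : ∀ t ∈ varSet k (lexSegment d u v) z, t < maxVar w := by
          intro t ht
          rcases ((hiff hzL).1 ht).2 with h | h
          · by_contra! hle'
            refine absurd (h.trans ((toLex_add_single_le_iff.2 hle').trans ?_)) hle.not_ge
            rw [hzs]
            exact le_rfl
          · exact h.trans_le hmax
        exact ⟨hzL, hzs, fun h => lt_irrefl _ (hlt _ h),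
          fun t ht => (hiff hw).2 ⟨((hiff hzL).1 ht).1, Or.inr (hlt t ht)⟩⟩
    · rw [lexVar, if_neg hs] at hy
      subst hy
      obtain rfl : z = w := by rw [hz, divVar, mulVar, add_tsub_cancel_right]
      exact ⟨hw, rfl, hs, subset_rfl⟩
  refine ⟨fun w hw s => (key w hw s _ _ rfl rfl).1, fun w hw s => (key w hw s _ _ rfl rfl).2.1,
    fun w hw s => (key w hw s _ _ rfl rfl).2.2.1, fun w hw s => (key w hw s _ _ rfl rfl).2.2.2,
    fun w hw s hs => ?_⟩
  rw [lexVar, if_neg hs, divVar, mulVar, add_tsub_cancel_right]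
  exact ⟨rfl, rfl⟩

end Lexsegment

end LexsegmentResolution

namespace LexsegmentResolution

/-! ### Alternating signs. -/

section Signs

variable {n : ℕ}

theorem alpha_erase_of_lt {σ : Finset (Fin n)} {s t : Fin n} (h : s < t) :
    alpha (σ.erase t) s = alpha σ s := by
  unfold alpha
  congr 1
  ext r
  simp only [Finset.mem_filter, Finset.mem_erase]
  exact ⟨fun h' => ⟨h'.1.2, h'.2⟩, fun h' => ⟨⟨(h'.2.trans h).ne, h'.1⟩, h'.2⟩⟩

theorem alpha_erase_add_one_of_lt {σ : Finset (Fin n)} {s t : Fin n} (hs : s ∈ σ) (h : s < t) :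
    alpha (σ.erase s) t + 1 = alpha σ t := by
  unfold alpha
  rw [Finset.filter_erase]
  exact Finset.card_erase_add_one (Finset.mem_filter.2 ⟨hs, h⟩)

theorem alpha_insert_of_lt {σ : Finset (Fin n)} {s t : Fin n} (hs : s ∉ σ) (h : s < t) :
    alpha (insert s σ) t = alpha σ t + 1 := by
  rw [← alpha_erase_add_one_of_lt (Finset.mem_insert_self s σ) h, Finset.erase_insert hs]

theorem alpha_eq_zero {σ : Finset (Fin n)} {s : Fin n} (h : ∀ t ∈ σ, s ≤ t) : alpha σ s = 0 := by
  rw [alpha, Finset.card_eq_zero, Finset.filter_eq_empty_iff]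
  exact fun t ht => (h t ht).not_gt

theorem neg_one_pow_alpha_antisymm {R : Type*} [CommRing R] {σ : Finset (Fin n)} {s t : Fin n}
    (hs : s ∈ σ) (ht : t ∈ σ) (h : s ≠ t) :
    (-1 : R) ^ alpha σ s * (-1) ^ alpha (σ.erase s) t =
      -((-1) ^ alpha σ t * (-1) ^ alpha (σ.erase t) s) := by
  rcases h.lt_or_gt with h | h
  · rw [alpha_erase_of_lt h, ← alpha_erase_add_one_of_lt hs h]
    ring
  · rw [alpha_erase_of_lt h, ← alpha_erase_add_one_of_lt ht h]
    ring

/-- Double alternating sums over a symmetric family vanish. -/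
theorem sum_sum_erase_alternating {R M : Type*} [CommRing R] [AddCommGroup M] [Module R M]
    (σ : Finset (Fin n)) (B : Fin n → Fin n → M) (hB : ∀ s t, B s t = B t s) :
    ∑ s ∈ σ, ∑ t ∈ σ.erase s, ((-1 : R) ^ alpha σ s * (-1) ^ alpha (σ.erase s) t) • B s t = 0 := by
  rw [Finset.sum_sigma']
  refine Finset.sum_involution (fun p _ => ⟨p.2, p.1⟩) ?_ ?_ ?_ ?_
  · rintro ⟨s, t⟩ hp
    simp only [Finset.mem_sigma, Finset.mem_erase] at hp
    rw [neg_one_pow_alpha_antisymm hp.1 hp.2.2 (Ne.symm hp.2.1), hB s t, neg_smul,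
      neg_add_cancel]
  · rintro ⟨s, t⟩ hp - h
    simp only [Finset.mem_sigma, Finset.mem_erase] at hp
    exact hp.2.1 (by simpa using congrArg Sigma.fst h)
  · rintro ⟨s, t⟩ hp
    simp only [Finset.mem_sigma, Finset.mem_erase] at hp ⊢
    exact ⟨hp.2.2, Ne.symm hp.2.1, hp.1⟩
  · rintro ⟨s, t⟩ _
    rfl

end Signs

/-! ### The differential and its square. -/

section Differential

variable {k : Type*} [Field k] {n : ℕ} [NeZero n] {T : Set (Mon n)}

/-- The set `σ` of the symbol `f(σ; w)`. -/
def SymIndex.face {i : ℕ} (p : SymIndex k T (i + 1)) : Finset (Fin n) := p.1.1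

/-- The generator `w` of the symbol `f(σ; w)`. -/
def SymIndex.gen {i : ℕ} (p : SymIndex k T (i + 1)) : Mon n := p.1.2

theorem SymIndex.gen_mem {i : ℕ} (p : SymIndex k T (i + 1)) : p.gen ∈ T := p.2.1

theorem SymIndex.face_subset {i : ℕ} (p : SymIndex k T (i + 1)) : p.face ⊆ varSet k T p.gen :=
  p.2.2.1

theorem SymIndex.card_face {i : ℕ} (p : SymIndex k T (i + 1)) : p.face.card = i := p.2.2.2

theorem SymIndex.ext {i : ℕ} {p q : SymIndex k T (i + 1)} (h₁ : p.face = q.face)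
    (h₂ : p.gen = q.gen) : p = q :=
  Subtype.ext (Prod.ext h₁ h₂)

theorem sym_eq_zero {i : ℕ} {σ : Finset (Fin n)} {w : Mon n}
    (h : ¬ (w ∈ T ∧ σ ⊆ varSet k T w ∧ σ.card = i)) : sym k T i σ w = 0 :=
  dif_neg h

theorem sym_face_gen {i : ℕ} (p : SymIndex k T (i + 1)) :
    sym k T i p.face p.gen = Finsupp.single p 1 :=
  dif_pos p.2

theorem exists_sym_eq_single {i : ℕ} {σ : Finset (Fin n)} {w : Mon n}
    (h : w ∈ T ∧ σ ⊆ varSet k T w ∧ σ.card = i) :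
    ∃ p : SymIndex k T (i + 1), p.face = σ ∧ p.gen = w ∧ sym k T i σ w = Finsupp.single p 1 :=
  ⟨⟨(σ, w), h⟩, rfl, rfl, dif_pos h⟩

/-- The Koszul part of the differential. -/
noncomputable def koszul (k : Type*) [Field k] (T : Set (Mon n)) (i : ℕ) :
    FreeMod k T (i + 2) →ₗ[MvPolynomial (Fin n) k] FreeMod k T (i + 1) :=
  Finsupp.linearCombination _ fun p => ∑ s ∈ p.face,
    ((-1) ^ alpha p.face s * X s : MvPolynomial (Fin n) k) • sym k T i (p.face.erase s) p.gen

/-- The part of the differential which lowers the generator. -/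
noncomputable def lower (k : Type*) [Field k] (T : Set (Mon n)) (y : Fin n → Mon n → Fin n)
    (g : Fin n → Mon n → Mon n) (i : ℕ) :
    FreeMod k T (i + 2) →ₗ[MvPolynomial (Fin n) k] FreeMod k T (i + 1) :=
  Finsupp.linearCombination _ fun p => ∑ s ∈ p.face,
    ((-1) ^ alpha p.face s * X (y s p.gen) : MvPolynomial (Fin n) k) •
      sym k T i (p.face.erase s) (g s p.gen)

/-- The differential of the resolution defined by a decomposition function. -/
noncomputable def differential (k : Type*) [Field k] (T : Set (Mon n)) (y : Fin n → Mon n → Fin n)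
    (g : Fin n → Mon n → Mon n) :
    ∀ i, FreeMod k T (i + 1) →ₗ[MvPolynomial (Fin n) k] FreeMod k T i
  | 0 => Finsupp.linearCombination _ fun p : SymIndex k T (0 + 1) =>
      monomial p.gen (1 : k) • one₀ k T
  | i + 1 => lower k T y g i - koszul k T i

variable {y : Fin n → Mon n → Fin n} {g : Fin n → Mon n → Mon n}

theorem koszul_sym {i : ℕ} {σ : Finset (Fin n)} {w : Mon n} (hσ : σ ⊆ varSet k T w) :
    koszul k T i (sym k T (i + 1) σ w) = ∑ s ∈ σ,
      ((-1) ^ alpha σ s * X s : MvPolynomial (Fin n) k) • sym k T i (σ.erase s) w := by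
  by_cases h : w ∈ T ∧ σ ⊆ varSet k T w ∧ σ.card = i + 1
  · obtain ⟨p, rfl, rfl, hp⟩ := exists_sym_eq_single h
    rw [hp, koszul, Finsupp.linearCombination_single, one_smul]
  · rw [sym_eq_zero h, map_zero]
    refine (Finset.sum_eq_zero fun s hs => ?_).symm
    rw [sym_eq_zero, smul_zero]
    rintro ⟨h1, -, h2⟩
    exact h ⟨h1, hσ, by rw [← Finset.card_erase_add_one hs, h2]⟩

theorem lower_sym {i : ℕ} {σ : Finset (Fin n)} {w : Mon n} (hw : w ∈ T) (hσ : σ ⊆ varSet k T w) :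
    lower k T y g i (sym k T (i + 1) σ w) = ∑ s ∈ σ,
      ((-1) ^ alpha σ s * X (y s w) : MvPolynomial (Fin n) k) •
        sym k T i (σ.erase s) (g s w) := by
  by_cases h : w ∈ T ∧ σ ⊆ varSet k T w ∧ σ.card = i + 1
  · obtain ⟨p, rfl, rfl, hp⟩ := exists_sym_eq_single h
    rw [hp, lower, Finsupp.linearCombination_single, one_smul]
  · rw [sym_eq_zero h, map_zero]
    refine (Finset.sum_eq_zero fun s hs => ?_).symm
    rw [sym_eq_zero, smul_zero]
    rintro ⟨h1, -, h2⟩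
    exact h ⟨hw, hσ, by rw [← Finset.card_erase_add_one hs, h2]⟩

theorem differential_zero_sym {w : Mon n} (hw : w ∈ T) :
    differential k T y g 0 (sym k T 0 ∅ w) = monomial w (1 : k) • one₀ k T := by
  obtain ⟨p, hp, rfl, h⟩ := exists_sym_eq_single (k := k) (T := T) (i := 0) (σ := ∅) (w := w)
    ⟨hw, Finset.empty_subset _, rfl⟩
  rw [h, differential, Finsupp.linearCombination_single, one_smul]

/-- No condition σ ⊆ set(w) is imposed, so the formula can be iterated at g_s(w), whose set may be
too small for σ \ s. If σ is not in set(w), both symbols vanish for s ∈ set(w) by regularity, and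
for s ∉ set(w) the two terms cancel because y_s(w) = s and g_s(w) = w. -/
theorem differential_sym (hg : IsRegularDecomposition k T y g) {i : ℕ} {σ : Finset (Fin n)}
    {w : Mon n} (hw : w ∈ T) :
    differential k T y g (i + 1) (sym k T (i + 1) σ w) = ∑ s ∈ σ,
      ((-1) ^ alpha σ s : MvPolynomial (Fin n) k) •
        ((X (y s w) : MvPolynomial (Fin n) k) • sym k T i (σ.erase s) (g s w)
          - (X s : MvPolynomial (Fin n) k) • sym k T i (σ.erase s) w) := by
  by_cases hσ : σ ⊆ varSet k T w
  · rw [differential, LinearMap.sub_apply, lower_sym hw hσ, koszul_sym hσ,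
      ← Finset.sum_sub_distrib]
    exact Finset.sum_congr rfl fun s _ => by rw [smul_sub, smul_smul, smul_smul]
  · rw [sym_eq_zero fun h => hσ h.2.1, map_zero]
    refine (Finset.sum_eq_zero fun s hs => ?_).symm
    by_cases hsw : s ∈ varSet k T w
    · have : ¬ σ.erase s ⊆ varSet k T w := fun h => hσ fun t ht => by
        by_cases hts : t = s
        · exact hts ▸ hsw
        · exact h (Finset.mem_erase.2 ⟨hts, ht⟩)
      rw [sym_eq_zero fun h => this h.2.1,
        sym_eq_zero fun h => this (h.2.1.trans (hg.subset w hw s))]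
      simp
    · rw [(hg.eq_of_notMem w hw s hsw).1, (hg.eq_of_notMem w hw s hsw).2, sub_self, smul_zero]

theorem linearMap_ext_sym {i : ℕ} {M : Type*} [AddCommMonoid M] [Module (MvPolynomial (Fin n) k) M]
    {f f' : FreeMod k T (i + 1) →ₗ[MvPolynomial (Fin n) k] M}
    (h : ∀ w ∈ T, ∀ σ ⊆ varSet k T w, σ.card = i → f (sym k T i σ w) = f' (sym k T i σ w)) :
    f = f' := by
  refine Finsupp.lhom_ext' fun p => LinearMap.ext_ring ?_
  simpa [sym_face_gen] using h _ p.gen_mem _ p.face_subset p.card_face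

theorem differential_comp_differential (hg : IsRegularDecomposition k T y g)
    (hT : HasLinearQuotients k T) (i : ℕ) :
    differential k T y g i ∘ₗ differential k T y g (i + 1) = 0 := by
  refine linearMap_ext_sym fun w hw σ hσ hc => ?_
  rw [LinearMap.comp_apply, LinearMap.zero_apply, differential_sym hg hw, map_sum]
  cases i with
  | zero =>
    refine Finset.sum_eq_zero fun s hs => ?_
    have : σ.erase s = ∅ := by
      rw [← Finset.card_eq_zero, Finset.card_erase_of_mem hs, hc]
    rw [this, map_smul, map_sub, map_smul, map_smul, differential_zero_sym hw,
      differential_zero_sym (hg.mem w hw s), smul_smul, smul_smul, X, X, monomial_mul,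
      monomial_mul, add_comm, hg.add_single_eq hw, add_comm, sub_self, smul_zero]
  | succ i =>
    -- Expanding ∂∂ gives for each pair s, t this family. It is symmetric by commutation of the
    -- decomposition function, so the signs cancel it.
    rw [← sum_sum_erase_alternating (R := MvPolynomial (Fin n) k) σ fun s t =>
      (X (y s w) * X (y t (g s w)) : MvPolynomial (Fin n) k) •
        sym k T i ((σ.erase s).erase t) (g t (g s w))
      - ((X (y s w) * X t : MvPolynomial (Fin n) k) • sym k T i ((σ.erase s).erase t) (g s w)
        + (X (y t w) * X s : MvPolynomial (Fin n) k) • sym k T i ((σ.erase s).erase t) (g t w))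
      + (X s * X t : MvPolynomial (Fin n) k) • sym k T i ((σ.erase s).erase t) w]
    · refine Finset.sum_congr rfl fun s hs => ?_
      rw [map_smul, map_sub, map_smul, map_smul, differential_sym hg hw,
        differential_sym hg (hg.mem w hw s), Finset.smul_sum, Finset.smul_sum,
        ← Finset.sum_sub_distrib, Finset.smul_sum]
      refine Finset.sum_congr rfl fun t ht => ?_
      module
    · intro s t
      rw [hg.X_mul_X_comm hT hw, hg.comm hT hw s t, Finset.erase_right_comm, mul_comm (X s) (X t),
        add_comm (_ • _) (_ • _)]

end Differential

end LexsegmentResolution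

namespace LexsegmentResolution

/-! ### The Koszul homotopy. -/

section Scalars

variable {k : Type*} [Field k] {n : ℕ}

theorem smul_monomial_X_smul {M : Type*} [AddCommGroup M] [Module (MvPolynomial (Fin n) k) M]
    (m : Mon n) (a : ℕ) (s : Fin n) (x : M) :
    monomial m (1 : k) • ((-1) ^ a * X s : MvPolynomial (Fin n) k) • x =
      ((-1) ^ a : MvPolynomial (Fin n) k) • monomial (m + Finsupp.single s 1) (1 : k) • x := by
  rw [smul_smul, smul_smul, X, mul_left_comm, monomial_mul, mul_one]

/-- The homotopy is only k-linear, but signs pass through every additive map. -/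
theorem map_neg_one_pow_smul {M N F : Type*} [AddCommGroup M] [AddCommGroup N]
    [Module (MvPolynomial (Fin n) k) M] [Module (MvPolynomial (Fin n) k) N] [FunLike F M N]
    [AddMonoidHomClass F M N] (f : F) (a : ℕ) (x : M) :
    f (((-1) ^ a : MvPolynomial (Fin n) k) • x) =
      ((-1) ^ a : MvPolynomial (Fin n) k) • f x := by
  rcases neg_one_pow_eq_or (MvPolynomial (Fin n) k) a with h | h <;> simp [h]

end Scalars

section Homotopy

variable (k : Type*) [Field k] {n : ℕ} [NeZero n] (T : Set (Mon n))

/-- The indices in `set w` involved in the element `x^m f(σ; w)`. -/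
noncomputable def activeVars (m : Mon n) (σ : Finset (Fin n)) (w : Mon n) : Finset (Fin n) :=
  (varSet k T w).filter fun s => s ∈ σ ∨ m s ≠ 0

/-- The contracting homotopy of the Koszul differential on `x^m f(σ; w)`. -/
noncomputable def homotopyGen (i : ℕ) (m : Mon n) (σ : Finset (Fin n)) (w : Mon n) :
    FreeMod k T (i + 1) :=
  if h : (activeVars k T m σ w).Nonempty then
    if (activeVars k T m σ w).min' h ∈ σ then 0
    else monomial (m - Finsupp.single ((activeVars k T m σ w).min' h) 1) (1 : k) •
      sym k T i (insert ((activeVars k T m σ w).min' h) σ) w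
  else 0

/-- The contracting homotopy of the Koszul differential. -/
noncomputable def homotopy (i : ℕ) : FreeMod k T (i + 1) →ₗ[k] FreeMod k T (i + 2) :=
  Finsupp.lsum k fun p : SymIndex k T (i + 1) =>
    (basisMonomials (Fin n) k).constr k fun m => homotopyGen k T (i + 1) m p.face p.gen

variable {k T}

theorem homotopy_monomial_smul_sym {i : ℕ} {m : Mon n} {σ : Finset (Fin n)} {w : Mon n}
    (hw : w ∈ T) (hσ : σ ⊆ varSet k T w) :
    homotopy k T i (monomial m (1 : k) • sym k T i σ w) = homotopyGen k T (i + 1) m σ w := by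
  by_cases h : w ∈ T ∧ σ ⊆ varSet k T w ∧ σ.card = i
  · obtain ⟨p, rfl, rfl, hp⟩ := exists_sym_eq_single h
    rw [hp, Finsupp.smul_single, smul_eq_mul, mul_one, homotopy, Finsupp.lsum_single]
    have := (basisMonomials (Fin n) k).constr_basis k
      (fun m => homotopyGen k T (i + 1) m p.face p.gen) m
    rwa [coe_basisMonomials] at this
  · rw [sym_eq_zero h, smul_zero, map_zero, homotopyGen]
    split_ifs with h1 h2
    · rfl
    · rw [sym_eq_zero, smul_zero]
      rintro ⟨-, -, h3⟩
      rw [Finset.card_insert_of_notMem h2, add_left_inj] at h3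
      exact h ⟨hw, hσ, h3⟩
    · rfl

theorem homotopyGen_of_isLeast {i : ℕ} {m : Mon n} {σ : Finset (Fin n)} {w : Mon n} {s : Fin n}
    (hs : IsLeast (activeVars k T m σ w : Set (Fin n)) s) :
    homotopyGen k T i m σ w = if s ∈ σ then 0 else
      monomial (m - Finsupp.single s 1) (1 : k) • sym k T i (insert s σ) w := by
  have hne : (activeVars k T m σ w).Nonempty := ⟨s, hs.1⟩
  have : (activeVars k T m σ w).min' hne = s :=
    IsLeast.unique (Finset.isLeast_min' _ hne) hs
  rw [homotopyGen, dif_pos hne]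
  simp only [this]

/-- A Koszul term moves s from σ into the monomial, so the active indices, and hence the least one
used by the homotopy, do not change. -/
theorem activeVars_erase {m : Mon n} {σ : Finset (Fin n)} {w : Mon n} {s : Fin n} (hs : s ∈ σ) :
    activeVars k T (m + Finsupp.single s 1) (σ.erase s) w = activeVars k T m σ w := by
  ext t
  simp only [activeVars, Finset.mem_filter, Finset.mem_erase]
  refine and_congr_right fun _ => ?_
  by_cases hst : s = t
  · subst hst
    simp [hs]
  · simp [Ne.symm hst]

/-- The homotopy identity on `x^m f(σ; w)`. -/
theorem koszul_homotopyGen {i : ℕ} {m : Mon n} {σ : Finset (Fin n)} {w : Mon n}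
    (hσ : σ ⊆ varSet k T w) (h : (activeVars k T m σ w).Nonempty) :
    koszul k T i (homotopyGen k T (i + 1) m σ w) +
      ∑ s ∈ σ, ((-1) ^ alpha σ s : MvPolynomial (Fin n) k) •
        homotopyGen k T i (m + Finsupp.single s 1) (σ.erase s) w =
      monomial m (1 : k) • sym k T i σ w := by
  obtain ⟨r, hr⟩ : ∃ r, IsLeast (activeVars k T m σ w : Set (Fin n)) r :=
    ⟨_, Finset.isLeast_min' _ h⟩
  have hr' : ∀ s ∈ σ, IsLeast
      (activeVars k T (m + Finsupp.single s 1) (σ.erase s) w : Set (Fin n)) r := fun s hs => by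
    rwa [activeVars_erase hs]
  have hrm := hr.1
  simp only [activeVars, Finset.coe_filter, Set.mem_ofPred_eq] at hrm
  have hle : ∀ s ∈ σ, r ≤ s := fun s hs => hr.2 (by simp [activeVars, hσ hs, hs])
  have hsum : ∑ s ∈ σ, ((-1) ^ alpha σ s : MvPolynomial (Fin n) k) •
        homotopyGen k T i (m + Finsupp.single s 1) (σ.erase s) w =
      ∑ s ∈ σ, ((-1) ^ alpha σ s : MvPolynomial (Fin n) k) •
        if r ∈ σ.erase s then 0 else
          monomial (m + Finsupp.single s 1 - Finsupp.single r 1) (1 : k) •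
            sym k T i (insert r (σ.erase s)) w :=
    Finset.sum_congr rfl fun s hs => by rw [homotopyGen_of_isLeast (hr' s hs)]
  rw [hsum, homotopyGen_of_isLeast hr]
  -- If the least active r lies in σ, only the term s = r survives, with sign 1. If not, the term s
  -- = r of the Koszul image is x^m f(σ; w), and the others cancel since inserting r shifts each α
  -- by one.
  by_cases hrσ : r ∈ σ
  · rw [if_pos hrσ, map_zero, zero_add, Finset.sum_eq_single_of_mem r hrσ]
    · rw [if_neg (Finset.notMem_erase r σ), alpha_eq_zero hle, pow_zero, one_smul,
        add_tsub_cancel_right, Finset.insert_erase hrσ]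
    · intro s _ hsr
      rw [if_pos (Finset.mem_erase.2 ⟨hsr.symm, hrσ⟩), smul_zero]
  · have hmr : Finsupp.single r 1 ≤ m := by
      rw [Finsupp.single_le_iff]
      exact Nat.one_le_iff_ne_zero.2 (hrm.2.resolve_left hrσ)
    rw [if_neg hrσ, map_smul, koszul_sym (Finset.insert_subset hrm.1 hσ),
      Finset.sum_insert hrσ, Finset.erase_insert hrσ, smul_add, smul_monomial_X_smul,
      tsub_add_cancel_of_le hmr, alpha_eq_zero fun s hs => ?_, pow_zero, one_smul, add_assoc,
      Finset.smul_sum, ← Finset.sum_add_distrib, Finset.sum_eq_zero, add_zero]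
    · intro s hs
      have hrs : r ≠ s := fun h => hrσ (h ▸ hs)
      rw [smul_monomial_X_smul, if_neg fun h => hrσ (Finset.mem_of_mem_erase h),
        Finset.erase_insert_of_ne hrs, alpha_insert_of_lt hrσ (lt_of_le_of_ne (hle s hs) hrs),
        pow_succ, mul_neg_one, neg_smul, tsub_add_eq_add_tsub hmr, neg_add_cancel]
    · rcases Finset.mem_insert.1 hs with rfl | hs
      · exact le_rfl
      · exact hle s hs

theorem homotopy_koszul {i : ℕ} {m : Mon n} {σ : Finset (Fin n)} {w : Mon n}
    (hw : w ∈ T) (hσ : σ ⊆ varSet k T w) :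
    homotopy k T i (koszul k T i (monomial m (1 : k) • sym k T (i + 1) σ w)) =
      ∑ s ∈ σ, ((-1) ^ alpha σ s : MvPolynomial (Fin n) k) •
        homotopyGen k T (i + 1) (m + Finsupp.single s 1) (σ.erase s) w := by
  rw [map_smul, koszul_sym hσ, Finset.smul_sum, map_sum]
  refine Finset.sum_congr rfl fun s _ => ?_
  rw [smul_monomial_X_smul, map_neg_one_pow_smul,
    homotopy_monomial_smul_sym hw ((Finset.erase_subset _ _).trans hσ)]

end Homotopy

/-! ### Filtration by generators and exactness. -/

section Filtration

variable {k : Type*} [Field k] {n : ℕ} [NeZero n] {T : Set (Mon n)}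

/-- The number of generators preceding `w`. -/
noncomputable def rank (T : Set (Mon n)) (w : Mon n) : ℕ := {z ∈ T | Prec z w}.ncard

theorem rank_lt_rank (hfin : T.Finite) {w w' : Mon n} (hw : w ∈ T) (h : Prec w w') :
    rank T w < rank T w' := by
  refine Set.ncard_lt_ncard ?_ (hfin.subset (Set.sep_subset _ _))
  refine ⟨fun z hz => ⟨hz.1, hz.2.trans h⟩, fun h' => Prec.irrefl w (h' ⟨hw, h⟩).2⟩

theorem rank_le_ncard (hfin : T.Finite) (w : Mon n) : rank T w ≤ T.ncard :=
  Set.ncard_le_ncard (Set.sep_subset _ _) hfin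

/-- The part of `F_{i+1}` spanned by the symbols of the first `N` generators. -/
noncomputable def filtration (k : Type*) [Field k] (T : Set (Mon n)) (i N : ℕ) :
    Submodule (MvPolynomial (Fin n) k) (FreeMod k T (i + 1)) :=
  Finsupp.supported _ _ {p : SymIndex k T (i + 1) | rank T p.gen < N}

theorem sym_mem_filtration {i N : ℕ} {σ : Finset (Fin n)} {w : Mon n} (h : rank T w < N) :
    sym k T i σ w ∈ filtration k T i N := by
  by_cases h' : w ∈ T ∧ σ ⊆ varSet k T w ∧ σ.card = i
  · obtain ⟨p, rfl, rfl, hp⟩ := exists_sym_eq_single h'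
    rw [hp]
    exact Finsupp.single_mem_supported _ _ h
  · rw [sym_eq_zero h']
    exact zero_mem _

theorem mem_filtration_of_ncard_lt (hfin : T.Finite) {i N : ℕ} (hN : T.ncard < N)
    (x : FreeMod k T (i + 1)) : x ∈ filtration k T i N :=
  fun p _ => (rank_le_ncard hfin p.gen).trans_lt hN

theorem eq_zero_of_mem_filtration_zero {i : ℕ} {x : FreeMod k T (i + 1)}
    (hx : x ∈ filtration k T i 0) : x = 0 := by
  rw [← Finsupp.support_eq_empty, Finset.eq_empty_iff_forall_notMem]
  exact fun p hp => absurd (hx hp) (Nat.not_lt_zero _)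

/-- To show that a `k`-linear map sends the filtration into a subspace it suffices to consider the
elements `x^m f(σ; w)`. -/
theorem map_mem_of_mem_filtration {i N : ℕ} {M : Type*} [AddCommMonoid M] [Module k M]
    (f : FreeMod k T (i + 1) →ₗ[k] M) (Q : Submodule k M)
    (h : ∀ w ∈ T, rank T w < N → ∀ σ ⊆ varSet k T w, σ.card = i → ∀ m : Mon n,
      f (monomial m (1 : k) • sym k T i σ w) ∈ Q) {x : FreeMod k T (i + 1)}
    (hx : x ∈ filtration k T i N) : f x ∈ Q := by
  rw [← Finsupp.sum_single x, Finsupp.sum, map_sum]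
  refine Submodule.sum_mem _ fun p hp => ?_
  rw [(x p).as_sum, Finsupp.single_finsetSum, map_sum]
  refine Submodule.sum_mem _ fun m _ => ?_
  have := h p.gen p.gen_mem (hx hp) p.face p.face_subset p.card_face m
  rw [sym_face_gen, Finsupp.smul_single, smul_eq_mul, mul_one] at this
  have heq : Finsupp.single p (monomial m (coeff m (x p))) =
      coeff m (x p) • Finsupp.single p (monomial m (1 : k)) := by
    rw [Finsupp.smul_single, smul_monomial, smul_eq_mul, mul_one]
  rw [heq, map_smul]
  exact Q.smul_mem _ this

theorem homotopyGen_mem_filtration {i N : ℕ} {m : Mon n} {σ : Finset (Fin n)} {w : Mon n}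
    (h : rank T w < N) : homotopyGen k T i m σ w ∈ filtration k T i N := by
  rw [homotopyGen]
  split_ifs
  · exact zero_mem _
  · exact Submodule.smul_mem _ _ (sym_mem_filtration h)
  · exact zero_mem _

theorem homotopy_mem_filtration {i N : ℕ} {x : FreeMod k T (i + 1)}
    (hx : x ∈ filtration k T i N) : homotopy k T i x ∈ filtration k T (i + 1) N := by
  refine map_mem_of_mem_filtration (homotopy k T i)
    ((filtration k T (i + 1) N).restrictScalars k) (fun w hw hN σ hσ _ m => ?_) hx
  rw [homotopy_monomial_smul_sym hw hσ]
  exact homotopyGen_mem_filtration hN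

variable {y : Fin n → Mon n → Fin n} {g : Fin n → Mon n → Mon n}

theorem lower_mem_filtration (hfin : T.Finite) (hg : IsRegularDecomposition k T y g) {i N : ℕ}
    {x : FreeMod k T (i + 2)} (hx : x ∈ filtration k T (i + 1) (N + 1)) :
    lower k T y g i x ∈ filtration k T i N := by
  refine map_mem_of_mem_filtration ((lower k T y g i).restrictScalars k)
    ((filtration k T i N).restrictScalars k) (fun w hw hN σ hσ _ m => ?_) hx
  rw [LinearMap.restrictScalars_apply, map_smul, lower_sym hw hσ]
  refine Submodule.smul_mem _ _ (Submodule.sum_mem _ fun s hs =>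
    Submodule.smul_mem _ _ (sym_mem_filtration ?_))
  have := rank_lt_rank hfin (hg.mem w hw s) (hg.prec hw (hσ hs))
  omega

/-- In this range σ ≠ ∅, so there is always an active index; this fails for f(∅; w), and F_1 is
treated separately. -/
theorem koszul_homotopy_add_homotopy_koszul (hfin : T.Finite) {i : ℕ} (x : FreeMod k T (i + 2)) :
    koszul k T (i + 1) (homotopy k T (i + 1) x) + homotopy k T i (koszul k T i x) = x := by
  have := map_mem_of_mem_filtration (N := T.ncard + 1)
    ((koszul k T (i + 1)).restrictScalars k ∘ₗ homotopy k T (i + 1) +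
      homotopy k T i ∘ₗ (koszul k T i).restrictScalars k - LinearMap.id) ⊥
    (fun w hw _ σ hσ hc m => ?_) (mem_filtration_of_ncard_lt hfin (Nat.lt_succ_self _) x)
  · rw [Submodule.mem_bot] at this
    exact sub_eq_zero.1 this
  · rw [Submodule.mem_bot]
    refine sub_eq_zero.2 ?_
    change koszul k T (i + 1) (homotopy k T (i + 1) _) + homotopy k T i (koszul k T i _) = _
    rw [homotopy_koszul hw hσ, homotopy_monomial_smul_sym hw hσ, koszul_homotopyGen hσ]
    · rfl
    · obtain ⟨s, hs⟩ : σ.Nonempty := Finset.card_pos.1 (by omega)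
      exact ⟨s, by simp [activeVars, hs, hσ hs]⟩

theorem exact_differential_succ (hfin : T.Finite) (hT : HasLinearQuotients k T)
    (hg : IsRegularDecomposition k T y g) (i : ℕ) :
    Function.Exact (differential k T y g (i + 2)) (differential k T y g (i + 1)) := by
  have hcomp : ∀ x, differential k T y g (i + 1) (differential k T y g (i + 2) x) = 0 :=
    LinearMap.congr_fun (differential_comp_differential hg hT (i + 1))
  have key : ∀ N, ∀ x ∈ filtration k T (i + 1) N, differential k T y g (i + 1) x = 0 →
      x ∈ LinearMap.range (differential k T y g (i + 2)) := by
    intro N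
    induction N with
    | zero =>
      intro x hx _
      rw [eq_zero_of_mem_filtration_zero hx]
      exact zero_mem _
    | succ N ih =>
      intro x hx hdx
      have hK : koszul k T i x = lower k T y g i x := (sub_eq_zero.1 hdx).symm
      -- Write K for the Koszul part. Then ∂(hx) = lower(hx) − K(hx), while x − K(hx) = h(Kx) =
      -- h(lower x), as x is a cycle. Both remaining terms contain a lowering.
      have heq : x + differential k T y g (i + 2) (homotopy k T (i + 1) x) =
          homotopy k T i (lower k T y g i x) +
            lower k T y g (i + 1) (homotopy k T (i + 1) x) := by
        have := koszul_homotopy_add_homotopy_koszul hfin x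
        rw [← hK]
        nth_rewrite 1 [← this]
        rw [differential, LinearMap.sub_apply]
        abel
      have hmem := ih (x + differential k T y g (i + 2) (homotopy k T (i + 1) x)) (by
        rw [heq]
        exact add_mem (homotopy_mem_filtration (lower_mem_filtration hfin hg hx))
          (lower_mem_filtration hfin hg (homotopy_mem_filtration hx)))
        (by rw [map_add, hdx, hcomp, add_zero])
      exact (Submodule.add_mem_iff_left _ (LinearMap.mem_range_self _ _)).1 hmem
  refine fun x => ⟨fun hx => key _ x (mem_filtration_of_ncard_lt hfin (Nat.lt_succ_self _) x) hx, ?_⟩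
  rintro ⟨z, rfl⟩
  exact hcomp z

/-- The elements of `F_1` which are combinations of `x^m f(∅; w)` with `x^m` a monomial in the
variables outside `set w`. -/
def normalForms (k : Type*) [Field k] (T : Set (Mon n)) : Submodule k (FreeMod k T 1) where
  carrier := {x | ∀ p : SymIndex k T (0 + 1), ∀ m, ∀ i ∈ varSet k T p.gen, m i ≠ 0 →
    coeff m (x p) = 0}
  zero_mem' p m i _ _ := by simp
  add_mem' hx hy p m i hi hm := by
    rw [Finsupp.add_apply, coeff_add, hx p m i hi hm, hy p m i hi hm, add_zero]
  smul_mem' c x hx p m i hi hm := by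
    rw [Finsupp.smul_apply, coeff_smul, hx p m i hi hm, smul_zero]

/-- On x^m f(∅; w) the operator is zero if some variable of set(w) divides x^m, and the identity
otherwise. -/
theorem sub_koszul_homotopy_mem_normalForms (hfin : T.Finite) (x : FreeMod k T 1) :
    x - koszul k T 0 (homotopy k T 0 x) ∈ normalForms k T := by
  refine map_mem_of_mem_filtration (i := 0) (N := T.ncard + 1)
    (LinearMap.id - (koszul k T 0).restrictScalars k ∘ₗ homotopy k T 0) (normalForms k T)
    (fun w hw _ σ hσ hc m => ?_) (mem_filtration_of_ncard_lt hfin (Nat.lt_succ_self _) x)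
  change _ - koszul k T 0 (homotopy k T 0 _) ∈ _
  obtain rfl : σ = ∅ := Finset.card_eq_zero.1 hc
  rw [homotopy_monomial_smul_sym hw hσ]
  by_cases h : (activeVars k T m ∅ w).Nonempty
  · have := koszul_homotopyGen (i := 0) hσ h
    rw [Finset.sum_empty, add_zero] at this
    rw [this]
    exact (sub_self (monomial m (1 : k) • sym k T 0 ∅ w)).symm ▸ zero_mem _
  · rw [homotopyGen, dif_neg h, map_zero]
    intro p l j hj hl
    obtain ⟨q, hq, rfl, hs⟩ := exists_sym_eq_single ⟨hw, hσ, hc⟩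
    change coeff l ((monomial m (1 : k) • sym k T 0 ∅ q.gen - 0 : FreeMod k T (0 + 1)) p) = 0
    rw [sub_zero, hs, Finsupp.smul_single, smul_eq_mul, mul_one]
    by_cases hpq : q = p
    · subst hpq
      rw [Finsupp.single_eq_same, coeff_monomial, if_neg]
      rintro rfl
      exact h ⟨j, by simp [activeVars, hj, hl]⟩
    · rw [Finsupp.single_eq_of_ne' hpq, coeff_zero]

theorem exists_add_differential_mem_normalForms (hfin : T.Finite)
    (hg : IsRegularDecomposition k T y g) (x : FreeMod k T 1) :
    ∃ z, x + differential k T y g 1 z ∈ normalForms k T := by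
  have key : ∀ N, ∀ x ∈ filtration k T 0 N,
      ∃ z, x + differential k T y g 1 z ∈ normalForms k T := by
    intro N
    induction N with
    | zero =>
      intro x hx
      refine ⟨0, ?_⟩
      rw [eq_zero_of_mem_filtration_zero hx, map_zero, add_zero]
      exact zero_mem _
    | succ N ih =>
      intro x hx
      obtain ⟨z, hz⟩ := ih _ (lower_mem_filtration hfin hg (homotopy_mem_filtration hx))
      refine ⟨homotopy k T 0 x + z, ?_⟩
      have : x + differential k T y g 1 (homotopy k T 0 x + z) =
          (x - koszul k T 0 (homotopy k T 0 x)) +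
            (lower k T y g 0 (homotopy k T 0 x) + differential k T y g 1 z) := by
        rw [map_add]
        nth_rewrite 1 [differential]
        rw [LinearMap.sub_apply]
        abel
      rw [this]
      exact add_mem (sub_koszul_homotopy_mem_normalForms hfin x) hz
  exact key _ x (mem_filtration_of_ncard_lt hfin (Nat.lt_succ_self _) x)

/-- The index of the generator of `F_0`. -/
def SymIndex.unit : SymIndex k T 0 := ()

theorem SymIndex.eq_unit (p : SymIndex k T 0) : p = SymIndex.unit := rfl

theorem one₀_eq : one₀ k T = Finsupp.single SymIndex.unit 1 := rfl

theorem differential_zero_apply (x : FreeMod k T 1) :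
    differential k T y g 0 x SymIndex.unit =
      x.sum fun (p : SymIndex k T (0 + 1)) q => q * monomial p.gen (1 : k) := by
  rw [differential, Finsupp.linearCombination_apply, Finsupp.sum_apply]
  refine Finsupp.sum_congr fun p _ => ?_
  rw [one₀_eq, Finsupp.smul_single, Finsupp.smul_single, Finsupp.single_eq_same, smul_eq_mul,
    smul_eq_mul, mul_one]

/-- By unique decomposition the products x^m w of normal-form terms are distinct, so the coefficient
of x^m w in ∂x is that of x^m f(∅; w) in x. -/
theorem eq_zero_of_mem_normalForms (hT : HasLinearQuotients k T) {x : FreeMod k T 1}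
    (hx : x ∈ normalForms k T) (h : differential k T y g 0 x = 0) : x = 0 := by
  refine Finsupp.ext fun (p : SymIndex k T (0 + 1)) => MvPolynomial.ext _ _ fun m => ?_
  by_contra hne
  rw [Finsupp.zero_apply, coeff_zero] at hne
  have hm : ∀ i ∈ varSet k T p.gen, m i = 0 := fun i hi => by
    by_contra h'
    exact hne (hx p m i hi h')
  have h0 := differential_zero_apply (y := y) (g := g) x
  rw [h] at h0
  have h1 := congrArg (coeff (m + p.gen)) h0
  rw [Finsupp.zero_apply, coeff_zero, Finsupp.sum, coeff_sum,
    Finset.sum_eq_single_of_mem p, coeff_mul_monomial, mul_one] at h1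
  · exact hne h1.symm
  · rw [Finsupp.mem_support_iff]
    intro h'
    exact hne (by rw [h', coeff_zero])
  · intro (q : SymIndex k T (0 + 1)) _ hqp
    rw [coeff_mul_monomial']
    split_ifs with hle
    · rw [mul_one]
      by_contra hne'
      obtain ⟨c, hc⟩ := exists_add_of_le hle
      rw [hc, add_tsub_cancel_left] at hne'
      refine hqp (SymIndex.ext ?_ ?_)
      · rw [Finset.card_eq_zero.1 q.card_face, Finset.card_eq_zero.1 p.card_face]
      · refine eq_of_add_eq_add hT q.gen_mem p.gen_mem (c := c) (c' := m) (fun i hi => ?_) hm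
          (by rw [add_comm, hc])
        by_contra h'
        exact hne' (hx q c i hi h')
    · rfl

theorem exact_differential_zero (hfin : T.Finite) (hT : HasLinearQuotients k T)
    (hg : IsRegularDecomposition k T y g) :
    Function.Exact (differential k T y g 1) (differential k T y g 0) := by
  have hcomp : ∀ x, differential k T y g 0 (differential k T y g 1 x) = 0 :=
    LinearMap.congr_fun (differential_comp_differential hg hT 0)
  refine fun x => ⟨fun hx => ?_, ?_⟩
  · obtain ⟨z, hz⟩ := exists_add_differential_mem_normalForms hfin hg x
    have := eq_zero_of_mem_normalForms (y := y) (g := g) hT hz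
      (by rw [map_add, hx, hcomp, add_zero])
    exact ⟨-z, by rw [map_neg]; exact (eq_neg_of_add_eq_zero_left this).symm⟩
  · rintro ⟨z, rfl⟩
    exact hcomp z

end Filtration

end LexsegmentResolution

namespace LexsegmentResolution

/-! ### Homogeneous elements of graded free modules. -/

section Graded

variable {k : Type*} [Field k] {n : ℕ} {ι : Type*} {deg : ι → ℕ} {j : ℕ}

theorem zero_mem_gradedPiece :
    (0 : ι →₀ MvPolynomial (Fin n) k) ∈ gradedPiece deg j := fun b m hm => by simp at hm

theorem add_mem_gradedPiece {x x' : ι →₀ MvPolynomial (Fin n) k} (hx : x ∈ gradedPiece deg j)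
    (hx' : x' ∈ gradedPiece deg j) : x + x' ∈ gradedPiece deg j := by
  classical
  intro b m hm
  rcases Finset.mem_union.1 (support_add hm) with h | h
  · exact hx b m h
  · exact hx' b m h

theorem sum_mem_gradedPiece {α : Type*} (s : Finset α) {f : α → ι →₀ MvPolynomial (Fin n) k}
    (h : ∀ a ∈ s, f a ∈ gradedPiece deg j) : ∑ a ∈ s, f a ∈ gradedPiece deg j :=
  Finset.sum_induction f (· ∈ gradedPiece deg j) (fun _ _ => add_mem_gradedPiece)
    zero_mem_gradedPiece h

theorem single_mem_gradedPiece {b : ι} {q : MvPolynomial (Fin n) k} {a : ℕ}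
    (hq : q.IsHomogeneous a) (ha : a + deg b = j) :
    Finsupp.single b q ∈ gradedPiece deg j := by
  intro c m hm
  by_cases hbc : b = c
  · subst hbc
    rw [Finsupp.single_eq_same, mem_support_iff] at hm
    rw [← ha, ← hq hm]
    exact congrArg (· + deg b) (DFunLike.congr_fun Finsupp.degree_eq_weight_one m)
  · rw [Finsupp.single_eq_of_ne' hbc] at hm
    simp at hm

end Graded

/-! ### Grading, minimality, augmentation and the general resolution theorem. -/

section Resolution

variable {k : Type*} [Field k] {n : ℕ} [NeZero n] {T : Set (Mon n)}
  {y : Fin n → Mon n → Fin n} {g : Fin n → Mon n → Mon n}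

theorem smul_sym_mem_gradedPiece {i j a : ℕ} {σ : Finset (Fin n)} {w : Mon n}
    {q : MvPolynomial (Fin n) k} (hq : q.IsHomogeneous a) (ha : a + (i + w.degree) = j) :
    q • sym k T i σ w ∈ gradedPiece (basisDeg k T (i + 1)) j := by
  by_cases h : w ∈ T ∧ σ ⊆ varSet k T w ∧ σ.card = i
  · obtain ⟨p, rfl, rfl, hp⟩ := exists_sym_eq_single h
    rw [hp, Finsupp.smul_single, smul_eq_mul, mul_one]
    refine single_mem_gradedPiece hq ?_
    rw [← ha]
    exact congrArg (fun c => a + (c + p.gen.degree)) p.card_face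
  · rw [sym_eq_zero h, smul_zero]
    exact zero_mem_gradedPiece

theorem differential_mem_gradedPiece (hg : IsRegularDecomposition k T y g) (i j : ℕ)
    {x : FreeMod k T (i + 1)} (hx : x ∈ gradedPiece (basisDeg k T (i + 1)) j) :
    differential k T y g i x ∈ gradedPiece (basisDeg k T i) j := by
  rw [← Finsupp.sum_single x, Finsupp.sum, map_sum]
  refine sum_mem_gradedPiece _ fun p hp => ?_
  have hdeg : ∀ m ∈ (x p).support, m.degree + (p.face.card + p.gen.degree) = j := hx p
  rw [p.card_face] at hdeg
  rw [← mul_one (x p), ← smul_eq_mul, ← Finsupp.smul_single, map_smul, ← sym_face_gen,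
    (x p).as_sum, Finset.sum_smul]
  refine sum_mem_gradedPiece _ fun m hm => ?_
  have hmon := isHomogeneous_monomial (coeff m (x p)) (rfl : m.degree = m.degree)
  cases i with
  | zero =>
    rw [Finset.card_eq_zero.1 p.card_face, differential_zero_sym p.gen_mem, one₀_eq,
      Finsupp.smul_single, Finsupp.smul_single, smul_eq_mul, smul_eq_mul, mul_one]
    refine single_mem_gradedPiece (hmon.mul (isHomogeneous_monomial _ rfl)) ?_
    rw [← hdeg m hm, zero_add]
    rfl
  | succ i =>
    rw [differential_sym hg p.gen_mem, Finset.smul_sum]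
    refine sum_mem_gradedPiece _ fun s _ => ?_
    have hsign : ((-1) ^ alpha p.face s : MvPolynomial (Fin n) k).IsHomogeneous 0 := by
      rcases neg_one_pow_eq_or (MvPolynomial (Fin n) k) (alpha p.face s) with h | h <;> rw [h]
      · exact isHomogeneous_one _ _
      · exact (isHomogeneous_one _ _).neg
    have hgd : (g s p.gen).degree = p.gen.degree :=
      degree_eq_of_add_single_eq (hg.add_single_eq p.gen_mem s)
    have hj := hdeg m hm
    rw [sub_eq_add_neg, ← neg_smul, smul_add, smul_add, smul_smul, smul_smul, smul_smul, smul_smul]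
    refine add_mem_gradedPiece
      (smul_sym_mem_gradedPiece ((hmon.mul hsign).mul (isHomogeneous_X _ _)) ?_)
      (smul_sym_mem_gradedPiece ((hmon.mul hsign).mul (isHomogeneous_X _ _).neg) ?_)
    · rw [hgd]
      omega
    · omega

theorem differential_mem_smul_top (hg : IsRegularDecomposition k T y g) (h0 : (0 : Mon n) ∉ T)
    (i : ℕ) (x : FreeMod k T (i + 1)) :
    differential k T y g i x ∈
      Ideal.span (Set.range (X : Fin n → MvPolynomial (Fin n) k)) •
        (⊤ : Submodule (MvPolynomial (Fin n) k) (FreeMod k T i)) := by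
  have hX : ∀ s : Fin n, (X s : MvPolynomial (Fin n) k) ∈
      Ideal.span (Set.range (X : Fin n → MvPolynomial (Fin n) k)) :=
    fun s => Ideal.subset_span ⟨s, rfl⟩
  rw [← Finsupp.sum_single x, Finsupp.sum, map_sum]
  refine Submodule.sum_mem _ fun p _ => ?_
  rw [← mul_one (x p), ← smul_eq_mul, ← Finsupp.smul_single, map_smul, ← sym_face_gen]
  refine Submodule.smul_mem _ _ ?_
  cases i with
  | zero =>
    rw [Finset.card_eq_zero.1 p.card_face, differential_zero_sym p.gen_mem]
    refine Submodule.smul_mem_smul ?_ trivial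
    obtain ⟨s, hs⟩ := Finsupp.support_nonempty_iff.2 fun h => h0 (h ▸ p.gen_mem)
    rw [← Set.image_univ, mem_ideal_span_X_image]
    intro m hm
    rw [Finset.mem_singleton.1 (support_monomial_subset hm)]
    exact ⟨s, trivial, Finsupp.mem_support_iff.1 hs⟩
  | succ i =>
    rw [differential_sym hg p.gen_mem]
    exact Submodule.sum_mem _ fun s _ => Submodule.smul_mem _ _ <| Submodule.sub_mem _
      (Submodule.smul_mem_smul (hX _) trivial) (Submodule.smul_mem_smul (hX _) trivial)

/-- The augmentation `F_0 = S → S/I`. -/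
noncomputable def augmentation (k : Type*) [Field k] (T : Set (Mon n)) :
    FreeMod k T 0 →ₗ[MvPolynomial (Fin n) k] (MvPolynomial (Fin n) k ⧸ monIdeal k T) :=
  (monIdeal k T).mkQ ∘ₗ Finsupp.lapply SymIndex.unit

theorem augmentation_apply (x : FreeMod k T 0) :
    augmentation k T x = Ideal.Quotient.mk (monIdeal k T) (x SymIndex.unit) := rfl

theorem eq_smul_one₀ (x : FreeMod k T 0) : x = x SymIndex.unit • one₀ k T := by
  refine Finsupp.ext fun p => ?_
  rw [p.eq_unit, one₀_eq, Finsupp.smul_single, Finsupp.single_eq_same, smul_eq_mul, mul_one]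

theorem exact_differential_augmentation :
    Function.Exact (differential k T y g 0) (augmentation k T) := by
  intro x
  rw [augmentation_apply, Ideal.Quotient.eq_zero_iff_mem]
  constructor
  · intro hx
    rw [eq_smul_one₀ x]
    have : monIdeal k T ≤ (LinearMap.range (differential k T y g 0)).comap
        (LinearMap.toSpanSingleton (MvPolynomial (Fin n) k) (FreeMod k T 0) (one₀ k T)) := by
      refine Ideal.span_le.2 ?_
      rintro _ ⟨w, hw, rfl⟩
      exact ⟨_, differential_zero_sym hw⟩
    exact this hx
  · rintro ⟨z, rfl⟩
    rw [differential_zero_apply]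
    exact Ideal.sum_mem _ fun p _ => Ideal.mul_mem_left _ _
      (Ideal.subset_span ⟨SymIndex.gen p, SymIndex.gen_mem p, rfl⟩)

theorem finite_symIndex (hfin : T.Finite) (i : ℕ) : Finite (SymIndex k T i) := by
  cases i with
  | zero => exact inferInstanceAs (Finite Unit)
  | succ i =>
    exact (((Set.toFinite (Set.univ : Set (Finset (Fin n)))).prod hfin).subset
      fun p (hp : p.2 ∈ T ∧ p.1 ⊆ varSet k T p.2 ∧ p.1.card = i) => ⟨trivial, hp.1⟩).to_subtype

/-- A monomial ideal with linear quotients and a regular decomposition function is resolved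
minimally by the symbols `f(σ; w)`. -/
theorem isMinimalGradedFreeResolution (hfin : T.Finite) (h0 : (0 : Mon n) ∉ T)
    (hT : HasLinearQuotients k T) (hg : IsRegularDecomposition k T y g) :
    IsMinimalGradedFreeResolution (monIdeal k T) (basisDeg k T) (differential k T y g)
      (augmentation k T) where
  finite_rank := finite_symIndex hfin
  surjective q := by
    obtain ⟨q, rfl⟩ := Ideal.Quotient.mk_surjective q
    exact ⟨Finsupp.single SymIndex.unit q, by rw [augmentation_apply, Finsupp.single_eq_same]⟩
  exact_zero := exact_differential_augmentation
  exact_succ i := by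
    cases i with
    | zero => exact exact_differential_zero hfin hT hg
    | succ i => exact exact_differential_succ hfin hT hg i
  homogeneous_augmentation j x hx := by
    refine ⟨x SymIndex.unit, fun m hm => ?_, augmentation_apply x⟩
    refine (DFunLike.congr_fun Finsupp.degree_eq_weight_one m).symm.trans ?_
    exact hx SymIndex.unit m (mem_support_iff.2 hm)
  homogeneous i j x hx := differential_mem_gradedPiece hg i j hx
  minimal i x := differential_mem_smul_top hg h0 i x

end Resolution

end LexsegmentResolution

/-! ### The resolution of a lexsegment ideal. -/

open LexsegmentResolution
theorem corollary1p9 {k : Type*} [Field k] {n : ℕ} [NeZero n] (d : ℕ) (hd : 2 ≤ d)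
    (u v : Mon n) (hu : u.degree = d) (hv : v.degree = d) (huv : toLex v ≤ toLex u)
    (L : Set (Mon n)) (hL : L = lexSegment d u v)
    (hcomplete : IsCompletelyLexSegment d L) (hquot : HasLinearQuotients k L) :
    ∃ (D : ∀ i, FreeMod k L (i + 1) →ₗ[MvPolynomial (Fin n) k] FreeMod k L i)
      (ε : FreeMod k L 0 →ₗ[MvPolynomial (Fin n) k]
        (MvPolynomial (Fin n) k ⧸ monIdeal k L)),
      IsMinimalGradedFreeResolution (monIdeal k L) (basisDeg k L) D ε ∧
      ε (one₀ k L) = 1 ∧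
      (∀ w ∈ L, D 0 (sym k L 0 ∅ w) = monomial w (1 : k) • one₀ k L) ∧
      (∀ i, ∀ w ∈ L, ∀ σ ⊆ varSet k L w, σ.card = i + 1 →
        D (i + 1) (sym k L (i + 1) σ w) =
          - (∑ s ∈ σ, ((-1) ^ alpha σ s * X s : MvPolynomial (Fin n) k) •
              sym k L i (σ.erase s) w)
          + (∑ s ∈ σ with toLex (mulVar s w) ≥ toLex (mulVar 0 v),
              ((-1) ^ alpha σ s * X 0 : MvPolynomial (Fin n) k) •
                sym k L i (σ.erase s) (divVar (mulVar s w) 0))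
          + (∑ s ∈ σ with toLex (mulVar s w) < toLex (mulVar 0 v),
              ((-1) ^ alpha σ s * X (maxVar w) : MvPolynomial (Fin n) k) •
                sym k L i (σ.erase s) (divVar (mulVar s w) (maxVar w)))) := by
  subst hL
  have hg := isRegularDecomposition_lexVar k hu hv hcomplete hquot
  refine ⟨_, _, isMinimalGradedFreeResolution (lexSegment_finite d u v) ?_ hquot hg, ?_,
    fun w hw => differential_zero_sym hw, fun i w hw σ hσ hc => ?_⟩
  · rintro ⟨h, -⟩
    rw [map_zero] at h
    omega
  · rw [augmentation_apply, one₀_eq, Finsupp.single_eq_same, map_one]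
  · rw [differential_sym hg hw, Finset.sum_filter, Finset.sum_filter, ← Finset.sum_neg_distrib,
      ← Finset.sum_add_distrib, ← Finset.sum_add_distrib]
    refine Finset.sum_congr rfl fun s hs => ?_
    -- Since s ∈ set(w), `lexVar` is x_1 or x_max(w), according to which of the two filtered sums
    -- contains s.
    simp only [lexVar, if_pos (hσ hs), ge_iff_le]
    by_cases h : toLex (mulVar 0 v) ≤ toLex (mulVar s w)
    · simp only [if_pos h, if_neg h.not_gt]
      module
    · simp only [if_neg h, if_pos (not_le.1 h)]
      module
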